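/- Let $K$ be a field of characteristic zero. For a homogeneous ideal $I$ of $R=K[x_1,\dots,x_n]$ give $A=R/I$ the standard grading $A=\bigoplus_{i\ge 0}A_i$ ($\deg x_i=1$). When $A$ is Artinian, $A$ is said to have the strong Lefschetz property if there is a linear form $z\in A_1$ such that, for all integers $d\ge 1$ and $i\ge 0$, the multiplication map $\times z^d\colon A_i\to A_{i+d}$ has full rank (that is, it is injective or surjective). **Theorem.** Let $n\ge 2$, let $d_1,\dots,d_n$ be positive integers, and let $$l_i=a_{i1}x_1+a_{i2}x_2+\cdots+a_{i,i+1}x_{i+1}\quad(1\le i\le n-1),\qquad l_n=a_{n1}x_1+a_{n2}x_2+\cdots+a_{nn}x_n,$$ with all $a_{ij}\in K$. Suppose that the ideal $$I=(x_1^{d_1}l_1,\;x_2^{d_2}l_2,\;\dots,\;x_n^{d_n}l_n)\subset R=K[x_1,\dots,x_n]$$ is an Artinian complete intersection ideal, i.e. $R/I$ is Artinian and $I$ is generated by a regular sequence. Then $R/I$ has the strong Lefschetz property. For $n=1$ and any positive integer $d_1$, the algebra $K[x_1]/(x_1^{d_1+1})$ has the strong Lefschetz property. -/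

import Mathlib

open MvPolynomial

noncomputable section

/-- The ideal `I` is a complete intersection ideal: it is generated by a regular sequence. -/
def IsCompleteIntersectionIdeal {R : Type*} [CommRing R] (I : Ideal R) : Prop :=
  ∃ rs : List R, RingTheory.Sequence.IsRegular R rs ∧ Ideal.ofList rs = I

/-- A linear map (between finite-dimensional spaces) has full (that is, maximal possible) rank:
it is injective or surjective. -/
def HasFullRank {K V W : Type*} [Field K] [AddCommGroup V] [Module K V] [AddCommGroup W]
    [Module K W] (f : V →ₗ[K] W) : Prop :=
  Function.Injective f ∨ Function.Surjective f

/-- For a linear form `z ∈ A₁` of a graded algebra `A = ⨁ Aᵢ`, the multiplication map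
`× z ^ d : Aᵢ → Aᵢ₊d`. -/
def mulPowMap {K A : Type*} [Field K] [CommRing A] [Algebra K A]
    (𝒜 : ℕ → Submodule K A) [SetLike.GradedMonoid 𝒜] (z : 𝒜 1) (d i : ℕ) :
    𝒜 i →ₗ[K] 𝒜 (i + d) :=
  (LinearMap.mulLeft K ((z : A) ^ d)).restrict (fun x hx => by
    have hz : (z : A) ^ d ∈ 𝒜 d := by
      simpa using SetLike.pow_mem_graded d z.2
    have h := SetLike.mul_mem_graded hx hz
    rwa [mul_comm] at h)

/-- The strong Lefschetz property of a graded algebra `A = ⨁ Aᵢ`: there is a linear form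
`z ∈ A₁` such that every map `× z ^ d : Aᵢ → Aᵢ₊d` has full rank. (If `A_c` is the last non-zero
piece, only `1 ≤ d ≤ c` and `i ≤ c - d` matter: in all other cases the map is the identity
or has zero target.) -/
def HasStrongLefschetzProperty {K A : Type*} [Field K] [CommRing A] [Algebra K A]
    (𝒜 : ℕ → Submodule K A) [SetLike.GradedMonoid 𝒜] : Prop :=
  ∃ z : 𝒜 1, ∀ d i : ℕ, HasFullRank (mulPowMap 𝒜 z d i)

/-- The standard grading of `K[x₁, …, xₙ] / I`: the piece of degree `i` is the image of the space
of homogeneous polynomials of degree `i`. -/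
def quotientGrading {K : Type*} [Field K] {n : ℕ} (I : Ideal (MvPolynomial (Fin n) K)) (i : ℕ) :
    Submodule K (MvPolynomial (Fin n) K ⧸ I) :=
  (homogeneousSubmodule (Fin n) K i).map (Ideal.Quotient.mkₐ K I).toLinearMap

instance quotientGrading.gradedMonoid {K : Type*} [Field K] {n : ℕ}
    (I : Ideal (MvPolynomial (Fin n) K)) : SetLike.GradedMonoid (quotientGrading I) where
  one_mem := ⟨1, isHomogeneous_one _ _, map_one (Ideal.Quotient.mkₐ K I)⟩
  mul_mem := by
    rintro i j _ _ ⟨f, hf, rfl⟩ ⟨g, hg, rfl⟩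
    exact ⟨f * g, IsHomogeneous.mul hf hg, map_mul (Ideal.Quotient.mkₐ K I) f g⟩

/-- The linear form `∑ⱼ a i j xⱼ` whose coefficients are the `i`-th row of the matrix `a`. -/
def linForm {K : Type*} [Field K] {n : ℕ} (a : Matrix (Fin n) (Fin n) K) (i : Fin n) :
    MvPolynomial (Fin n) K :=
  ∑ j, C (a i j) * X j

end

/-!
The proof is an induction on the number of variables by means of *central simple modules*. For a
graded Artinian algebra `A` with a linear form `z`, these are the modules `((0 : z ^ (f + 1)) + z
A) / ((0 : z ^ f) + z A)`, `f ≥ 0`. If `A` is symmetric about `c / 2` and `y` is a linear form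
having the Lefschetz property on all of them, each with centre `(c - f) / 2`, then `z + t y` has
the Lefschetz property on `A` for all but finitely many `t`
(`CentralSimpleLefschetz.exists_lefschetzSurjective`). Indeed the associated graded ring of `A`
for the `z`-adic filtration is filtered by the tensor products of the central simple modules with
`K[T] / (T ^ (f + 1))`, all of them centred at `c / 2`; on each, `y + T` has the Lefschetz
property because `K[Y, T] / (Y ^ κ, T ^ f)` has it in characteristic zero
(`forall_mem_of_binomial_relations`); and the property passes from the associated graded ring to
nearby parameters. Only the surjectivity half is treated in this way, as it survives extensions
and needs no dimension count.

For `A = R / (x₁ ^ d₁ l₁, …, xₙ ^ dₙ lₙ)` and `z = x₁`, multiplication by `x₁ ^ d₁` identifies `B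
= R / (l₁, x₂ ^ d₂ l₂, …)` with an ideal of `A`. The central simple modules of `(A, x₁)` are those
of `(B, x₁)`, with `f` raised by `d₁`, and one more, the ideal generated by `l₁` in `R / (x₁, x₂ ^
d₂ l₂, …)` (`CentralSimpleLefschetz.of_pow_mul`). If `x₂` occurs in `l₁`, then this ideal is
generated by `x₂` and is a shift of `U = R / (x₁, x₂ ^ (d₂ - 1) l₂, x₃ ^ d₃ l₃, …)`, while in `B`
the variables `x₁` and `x₂` agree up to a scalar; so `B` and `U` are algebras of the same kind in
one variable less, and the triangular shape of the `lᵢ` is preserved. If `x₂` does not occur in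
`l₁`, only `R / (x₁, x₂ ^ d₂ l₂, …)` is left. This is `genericLinear_lefschetz_mixedIdeal`; there
all algebras are quotients of the same ring `R`, by ideals some of whose generators are linear
forms.

The regularity of `x₁` modulo `x₂ ^ d₂ l₂, …, xₙ ^ dₙ lₙ` comes from an elementary statement on
products of linear forms whose only common zero in `Kⁿ` is the origin
(`mem_span_of_linear_mul_mem`); this condition follows from `A` being Artinian and is inherited by
`B` and `U`. The injectivity half of the strong Lefschetz property follows from the surjectivity
half, because the socle of `A` lies in the single degree `d₁ + ⋯ + dₙ`
(`exists_mul_notMem_mixedIdeal`).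
-/

/-! ### Homogeneous ideals and homogeneous components -/

section Homogeneous

variable {σ K : Type*} [Field K]

lemma homogeneousComponent_mul_of_le {p q : MvPolynomial σ K} {m j : ℕ}
    (hp : p.IsHomogeneous m) (h : m ≤ j) :
    homogeneousComponent j (p * q) = p * homogeneousComponent (j - m) q := by
  let _ := MvPolynomial.gradedAlgebra (σ := σ) (R := K)
  have := DirectSum.coe_decompose_mul_of_left_mem_of_le (homogeneousSubmodule σ K) (n := j)
    (b := q) hp h
  rw [← decomposition.decompose'_apply, ← decomposition.decompose'_apply]
  exact this

lemma homogeneousComponent_mul_of_lt {p q : MvPolynomial σ K} {m j : ℕ}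
    (hp : p.IsHomogeneous m) (h : j < m) :
    homogeneousComponent j (p * q) = 0 := by
  let _ := MvPolynomial.gradedAlgebra (σ := σ) (R := K)
  have := DirectSum.coe_decompose_mul_of_left_mem_of_not_le (homogeneousSubmodule σ K) (n := j)
    (b := q) hp (not_le.mpr h)
  rw [← decomposition.decompose'_apply]
  exact this

/-- An ideal of a polynomial ring is closed under taking homogeneous components. -/
def IsHomogeneousIdeal (J : Ideal (MvPolynomial σ K)) : Prop :=
  ∀ a ∈ J, ∀ i, homogeneousComponent i a ∈ J

lemma isHomogeneousIdeal_span {ι : Type*} (g : ι → MvPolynomial σ K) (e : ι → ℕ)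
    (hg : ∀ i, (g i).IsHomogeneous (e i)) : IsHomogeneousIdeal (Ideal.span (Set.range g)) := by
  intro a ha j
  let _ := MvPolynomial.gradedAlgebra (σ := σ) (R := K)
  refine homogeneousComponent_mem_of_mem (Ideal.homogeneous_span _ _ ?_) ha j
  rintro _ ⟨i, rfl⟩
  exact ⟨e i, hg i⟩

/-- The factor `b` in `a ≡ p * b` modulo a homogeneous ideal can be taken homogeneous. -/
lemma exists_homogeneous_factor {J : Ideal (MvPolynomial σ K)} (hJ : IsHomogeneousIdeal J)
    {a p b : MvPolynomial σ K} {j m : ℕ} (ha : a.IsHomogeneous j) (hp : p.IsHomogeneous m)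
    (h : a - p * b ∈ J) :
    a ∈ J ∧ j < m ∨ m ≤ j ∧ ∃ b' : MvPolynomial σ K, b'.IsHomogeneous (j - m) ∧ a - p * b' ∈ J := by
  have h1 := hJ _ h j
  rw [map_sub, homogeneousComponent_eq_self ha] at h1
  rcases lt_or_ge j m with hm | hm
  · rw [homogeneousComponent_mul_of_lt hp hm, sub_zero] at h1
    exact Or.inl ⟨h1, hm⟩
  · rw [homogeneousComponent_mul_of_le hp hm] at h1
    exact Or.inr ⟨hm, _, homogeneousComponent_isHomogeneous _ _, h1⟩

end Homogeneous

/-! ### Generic linear forms -/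

section Generic

variable {σ K : Type*} [Field K]

/-- A property `S` holds for *generic* linear forms: it is implied by a property which some linear
form has, and which is open on lines, that is, it persists at all but finitely many points of each
line of linear forms through a point where it holds. -/
def GenericLinear (S : MvPolynomial σ K → Prop) : Prop :=
  ∃ S' : MvPolynomial σ K → Prop, (∀ y, y.IsHomogeneous 1 → S' y → S y) ∧
    (∃ y, y.IsHomogeneous 1 ∧ S' y) ∧
    ∀ y w, y.IsHomogeneous 1 → w.IsHomogeneous 1 → S' y →
      ∀ᶠ s : K in Filter.cofinite, S' (y + C s * w)

lemma GenericLinear.exists {S : MvPolynomial σ K → Prop} (h : GenericLinear S) :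
    ∃ y, y.IsHomogeneous 1 ∧ S y := by
  obtain ⟨S', h1, ⟨y, hy, hy'⟩, _⟩ := h
  exact ⟨y, hy, h1 y hy hy'⟩

lemma GenericLinear.mono {S T : MvPolynomial σ K → Prop} (h : GenericLinear S)
    (hST : ∀ y, y.IsHomogeneous 1 → S y → T y) : GenericLinear T := by
  obtain ⟨S', h1, h2, h3⟩ := h
  exact ⟨S', fun y hy h => hST y hy (h1 y hy h), h2, h3⟩

lemma GenericLinear.and [Infinite K] {S T : MvPolynomial σ K → Prop} (hS : GenericLinear S)
    (hT : GenericLinear T) : GenericLinear fun y => S y ∧ T y := by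
  obtain ⟨S', hS1, ⟨y, hy, hy'⟩, hS3⟩ := hS
  obtain ⟨T', hT1, ⟨w, hw, hw'⟩, hT3⟩ := hT
  refine ⟨fun y => S' y ∧ T' y, fun x hx h => ⟨hS1 x hx h.1, hT1 x hx h.2⟩, ?_,
    fun y w hy hw h => (hS3 y w hy hw h.1).and (hT3 y w hy hw h.2)⟩
  -- intersect the two open sets on the line joining `y` to `w`
  have e1 := hS3 y (w - y) hy (hw.sub hy) hy'
  have e2 := hT3 w (y - w) hw (hy.sub hw) hw'
  have e3 : ∀ᶠ s : K in Filter.cofinite, T' (w + C (1 - s) * (y - w)) :=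
    ((sub_right_injective (b := (1 : K))).tendsto_cofinite).eventually e2
  obtain ⟨s, h1, h2⟩ := (e1.and e3).exists
  refine ⟨y + C s * (w - y), hy.add ((hw.sub hy).C_mul s), h1, ?_⟩
  convert h2 using 1
  rw [C_sub, C_1]; ring

end Generic

/-! ### Polynomial families of endomorphisms -/

/-- A polynomial family of endomorphisms which is the identity at `0` is surjective at all but
finitely many parameters. -/
lemma eventually_surjective_sum_pow_smul {K E : Type*} [Field K] [AddCommGroup E] [Module K E]
    [FiniteDimensional K E] (N : ℕ) (A : ℕ → Module.End K E) (h0 : A 0 = 1) :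
    ∀ᶠ s : K in Filter.cofinite,
      Function.Surjective (∑ i ∈ Finset.range (N + 1), s ^ i • A i : Module.End K E) := by
  classical
  let b := Module.finBasis K E
  let P : Matrix _ _ (Polynomial K) := ∑ i ∈ Finset.range (N + 1),
    (Polynomial.X ^ i : Polynomial K) • (LinearMap.toMatrix b b (A i)).map Polynomial.C
  have hP : ∀ s : K, P.map (Polynomial.eval s)
      = LinearMap.toMatrix b b (∑ i ∈ Finset.range (N + 1), s ^ i • A i) := by
    intro s
    ext x y
    simp [P, Matrix.sum_apply, Polynomial.eval_finsetSum, mul_comm (_ ^ _ : K)]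
  have hdet : ∀ s : K, P.det.eval s = LinearMap.det (∑ i ∈ Finset.range (N + 1), s ^ i • A i) := by
    intro s
    rw [← LinearMap.det_toMatrix b, ← hP, ← Polynomial.coe_evalRingHom, RingHom.map_det]
    rfl
  have hne : P.det ≠ 0 := by
    intro h
    have := hdet 0
    rw [h, Finset.sum_eq_single 0 (by intro i _ hi; simp [hi]) (by simp)] at this
    simp [h0] at this
  have hfin : {s : K | P.det.IsRoot s}.Finite := Polynomial.finite_setOfPred_isRoot hne
  refine (Filter.eventually_cofinite.mpr (hfin.subset ?_))
  intro s hs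
  by_contra hroot
  apply hs
  have : IsUnit (LinearMap.det (∑ i ∈ Finset.range (N + 1), s ^ i • A i)) := by
    rw [← hdet]; exact isUnit_iff_ne_zero.mpr hroot
  convert (LinearMap.equivOfIsUnitDet this).surjective using 1
  ext; simp

/-! ### Vanishing of sequences with many zeros and vanishing finite differences -/

/-- A sequence whose `m`-th finite differences vanish on `{0, …, D}` is given there by a
polynomial of degree less than `m`. -/
lemma exists_polynomial_of_fwdDiff_iter_eq_zero {K : Type*} [Field K] [CharZero K] (ψ : ℕ → K)
    (m D : ℕ) (h : ∀ s, s + m ≤ D → (fwdDiff 1)^[m] ψ s = 0) :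
    ∃ P : Polynomial K, P.degree < m ∧ ∀ j ≤ D, P.eval (j : K) = ψ j := by
  refine ⟨∑ k ∈ Finset.range m, Polynomial.C ((fwdDiff 1)^[k] ψ 0 * ((k.factorial : K))⁻¹) *
    descPochhammer K k, ?_, ?_⟩
  · rw [← Polynomial.mem_degreeLT]
    refine Submodule.sum_mem _ fun k hk => ?_
    rw [Polynomial.mem_degreeLT]
    rw [← Polynomial.smul_eq_C_mul]
    refine lt_of_le_of_lt (Polynomial.degree_smul_le _ _) ?_
    refine lt_of_le_of_lt Polynomial.degree_le_natDegree ?_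
    rw [descPochhammer_natDegree]
    exact_mod_cast Finset.mem_range.mp hk
  · intro j hj
    have hshift := shift_eq_sum_fwdDiff_iter 1 ψ j 0
    simp only [zero_add, smul_eq_mul, mul_one] at hshift
    rw [hshift, Polynomial.eval_finsetSum]
    have hterm : ∀ k, (Polynomial.C ((fwdDiff 1)^[k] ψ 0 * ((k.factorial : K))⁻¹) *
        descPochhammer K k).eval (j : K) = j.choose k • (fwdDiff 1)^[k] ψ 0 := by
      intro k
      have hk : (k.factorial : K) ≠ 0 := by exact_mod_cast k.factorial_ne_zero
      rw [Polynomial.eval_mul, Polynomial.eval_C, descPochhammer_eval_eq_descFactorial,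
        Nat.descFactorial_eq_factorial_mul_choose, nsmul_eq_mul]
      push_cast
      field_simp
    simp_rw [hterm]
    have hz : ∀ k, m ≤ k → k ≤ j → (fwdDiff 1)^[k] ψ 0 = 0 := by
      intro k hmk hkj
      obtain ⟨r, rfl⟩ := Nat.exists_eq_add_of_le hmk
      rw [add_comm, Function.iterate_add_apply, fwdDiff_iter_eq_sum_shift]
      refine Finset.sum_eq_zero fun i hi => ?_
      rw [h _ (by have := Finset.mem_range.mp hi; simp; omega), smul_zero]
    rcases le_total m (j + 1) with hm | hm
    · refine Finset.sum_subset (by simpa using hm) ?_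
      intro k hk hk'
      rw [Finset.mem_range] at hk hk'
      rw [hz k (by omega) (by omega), smul_zero]
    · refine (Finset.sum_subset (by simpa using hm) ?_).symm
      intro k hk hk'
      rw [Finset.mem_range] at hk hk'
      rw [Nat.choose_eq_zero_of_lt (by omega), zero_smul]

/-- In characteristic zero, all monomials of degree `D` in two variables `Y, T` lie in
the ideal `((Y + T) ^ m, Y ^ κ, T ^ f)` as soon as `2 * D = κ + f + m - 2`. Here `e s` stands for
`Y ^ s * T ^ (D - s)`, and `W` for the ideal. A linear form vanishing on `W` gives, up to signs, a
sequence with vanishing `m`-th differences, that is, a polynomial sequence of degree less than `m`;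
it has `m` zeros. -/
lemma forall_mem_of_binomial_relations {K V : Type*} [Field K] [CharZero K] [AddCommGroup V]
    [Module K V] (W : Submodule K V) (e : ℕ → V) {D κ f m : ℕ} (hD : 2 * D + 2 = κ + f + m)
    (hY : ∀ s ≤ D, κ ≤ s → e s ∈ W) (hT : ∀ s ≤ D, s + f ≤ D → e s ∈ W)
    (hYT : ∀ s, s + m ≤ D → ∑ i ∈ Finset.range (m + 1), m.choose i • e (s + i) ∈ W) :
    ∀ s ≤ D, e s ∈ W := by
  intro s hs
  by_cases hκf : κ + f ≤ D + 1
  · rcases le_or_gt κ s with h | h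
    · exact hY s hs h
    · exact hT s hs (by omega)
  by_contra hes
  obtain ⟨φ, hφ, hW⟩ := Submodule.exists_le_ker_of_notMem hes
  have hW' : ∀ w ∈ W, φ w = 0 := fun w hw => hW hw
  obtain ⟨P, hP, hPe⟩ := exists_polynomial_of_fwdDiff_iter_eq_zero
    (fun j => (-1 : K) ^ j * φ (e j)) m D (by
      intro s hs
      have h := hW' _ (hYT s hs)
      rw [map_sum] at h
      simp_rw [map_nsmul, nsmul_eq_mul] at h
      rw [fwdDiff_iter_eq_sum_shift]
      rw [← mul_zero ((-1 : K) ^ (s + m)), ← h, Finset.mul_sum]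
      refine Finset.sum_congr rfl fun i hi => ?_
      have hi : i ≤ m := by have := Finset.mem_range.mp hi; omega
      obtain ⟨r, rfl⟩ := Nat.exists_eq_add_of_le hi
      simp only [zsmul_eq_mul, smul_eq_mul, mul_one, add_tsub_cancel_left, pow_add]
      push_cast
      ring)
  have hP0 : P = 0 := by
    classical
    let Z := Finset.range (D + 1 - f) ∪ Finset.Ico κ (D + 1)
    have hZ : m ≤ Z.card := by
      rw [Finset.card_union_of_disjoint, Finset.card_range, Nat.card_Ico]
      · omega
      · rw [Finset.disjoint_left]
        intro j h1 h2
        rw [Finset.mem_range] at h1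
        rw [Finset.mem_Ico] at h2
        omega
    have hzero : ∀ z ∈ Z.image (Nat.cast : ℕ → K), P.eval z = 0 := by
      intro z hz
      obtain ⟨j, hj, rfl⟩ := Finset.mem_image.mp hz
      obtain ⟨hjD, hj⟩ : j ≤ D ∧ (κ ≤ j ∨ j + f ≤ D) := by
        rw [Finset.mem_union, Finset.mem_range, Finset.mem_Ico] at hj
        omega
      rw [hPe j hjD, hW' (e j) (hj.elim (hY j hjD) (hT j hjD)), mul_zero]
    refine Polynomial.eq_zero_of_degree_lt_of_eval_finset_eq_zero _ ?_ hzero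
    rw [Finset.card_image_of_injective _ Nat.cast_injective]
    exact hP.trans_le (by exact_mod_cast hZ)
  have := hPe s hs
  rw [hP0, Polynomial.eval_zero, zero_eq_mul] at this
  exact this.elim (by simp) hφ

/-- A linear relation that is total contains the graph of a linear map. -/
lemma exists_linearMap_of_relation {K E F : Type*} [Field K] [AddCommGroup E] [Module K E]
    [AddCommGroup F] [Module K F] (P : Submodule K (E × F)) (h : ∀ e, ∃ f, (e, f) ∈ P) :
    ∃ β : E →ₗ[K] F, ∀ e, (e, β e) ∈ P := by
  obtain ⟨γ, hγ⟩ := LinearMap.exists_rightInverse_of_surjective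
    ((LinearMap.fst K E F).comp P.subtype) (LinearMap.range_eq_top.mpr fun e => by
      obtain ⟨f, hf⟩ := h e
      exact ⟨⟨_, hf⟩, rfl⟩)
  refine ⟨(LinearMap.snd K E F).comp (P.subtype.comp γ), fun e => ?_⟩
  have h1 : ((γ e : E × F)).1 = e := LinearMap.congr_fun hγ e
  have h2 : ((e, (γ e : E × F).2) : E × F) = γ e := Prod.ext h1.symm rfl
  change ((e, (γ e : E × F).2) : E × F) ∈ P
  rw [h2]
  exact (γ e).2

/-! ### Lefschetz conditions modulo a homogeneous ideal -/

section Lefschetz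

variable {σ K : Type*} [Field K]

/-- The surjectivity half of the strong Lefschetz property of `A = K[σ] / J` with centre `c / 2`,
for the linear form `L`: the map `× L ^ m : A_{j - m} → A_j` is surjective whenever `2 * j = c + m`,
that is, whenever its source and target are symmetric about `c / 2`. The preimage is not required
to be homogeneous, as it can be made so; for `j < m` the condition says that `A_j = 0`. -/
def LefschetzSurjective (J : Ideal (MvPolynomial σ K)) (c : ℕ) (L : MvPolynomial σ K) : Prop :=
  ∀ j m : ℕ, 2 * j = c + m → ∀ a : MvPolynomial σ K, a.IsHomogeneous j → ∃ b, a - L ^ m * b ∈ J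

/-- The linear form `y` has surjective Lefschetz maps on all central simple modules of
`(A, z)`, where `A = K[σ] / J`. For `f ≥ 0` the central simple module in question is
`((0 : z ^ (f + 1)) + z A) / ((0 : z ^ f) + z A)`, and its centre is `(c - f) / 2`. -/
def CentralSimpleLefschetz (J : Ideal (MvPolynomial σ K)) (z : MvPolynomial σ K) (c : ℕ)
    (y : MvPolynomial σ K) : Prop :=
  ∀ f j m : ℕ, 2 * j + f = c + m → ∀ a : MvPolynomial σ K, a.IsHomogeneous j →
    z ^ (f + 1) * a ∈ J → ∃ b g h, z ^ (f + 1) * b ∈ J ∧ z ^ f * h ∈ J ∧ a = y ^ m * b + z * g + h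

variable {J : Ideal (MvPolynomial σ K)} {c : ℕ}

/-- It is enough to test degrees up to `c + 1`: in degree `c + 1` the condition says that this
graded piece of `K[σ] / J` vanishes, and then so do the later ones. -/
lemma LefschetzSurjective.of_le (hJ : IsHomogeneousIdeal J) {L : MvPolynomial σ K}
    (hL : L.IsHomogeneous 1)
    (h : ∀ j m : ℕ, j ≤ c + 1 → 2 * j = c + m → ∀ a : MvPolynomial σ K, a.IsHomogeneous j →
      ∃ b, a - L ^ m * b ∈ J) : LefschetzSurjective J c L := by
  have htop : ∀ r (a : MvPolynomial σ K), a.IsHomogeneous (c + 1 + r) → a ∈ J := by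
    have hbase : ∀ a : MvPolynomial σ K, a.IsHomogeneous (c + 1) → a ∈ J := by
      intro a ha
      obtain ⟨b, hb⟩ := h (c + 1) (c + 2) le_rfl (by omega) a ha
      rcases exists_homogeneous_factor hJ ha (by simpa using hL.pow (c + 2)) hb with h | h
      · exact h.1
      · omega
    intro r a ha
    have ha' : a ∈ homogeneousSubmodule σ K (c + 1) * homogeneousSubmodule σ K r := by
      rw [← homogeneousSubmodule_one_pow (R := K) (c + 1),
        ← homogeneousSubmodule_one_pow (R := K) r, ← pow_add,
        homogeneousSubmodule_one_pow]
      exact ha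
    refine Submodule.mul_induction_on ha' (fun p hp q _ => ?_) fun p q hp hq => add_mem hp hq
    exact J.mul_mem_right _ (hbase p hp)
  intro j m hjm a ha
  rcases le_or_gt j (c + 1) with hj | hj
  · exact h j m hj hjm a ha
  · refine ⟨0, ?_⟩
    rw [mul_zero, sub_zero]
    obtain ⟨r, rfl⟩ := Nat.exists_eq_add_of_lt hj
    exact htop (r + 1) a ha

instance [Finite σ] (i : ℕ) : FiniteDimensional K (homogeneousSubmodule σ K i) :=
  Module.Finite.iff_fg.mpr (homogeneousSubmodule_fg σ K i)

/-- Lefschetz surjectivity is an open condition on every line of linear forms. -/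
lemma LefschetzSurjective.eventually [Finite σ] (hJ : IsHomogeneousIdeal J) {y w : MvPolynomial σ K}
    (hy : y.IsHomogeneous 1) (hw : w.IsHomogeneous 1) (h : LefschetzSurjective J c y) :
    ∀ᶠ s : K in Filter.cofinite, LefschetzSurjective J c (y + C s * w) := by
  have key : ∀ j m : ℕ, 2 * j = c + m → ∀ᶠ s : K in Filter.cofinite,
      ∀ a : MvPolynomial σ K, a.IsHomogeneous j → ∃ b, a - (y + C s * w) ^ m * b ∈ J := by
    intro j m hjm
    rcases lt_or_ge j m with hmj | hmj
    · refine Filter.Eventually.of_forall fun s a ha => ⟨0, ?_⟩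
      obtain ⟨b, hb⟩ := h j m hjm a ha
      rcases exists_homogeneous_factor hJ ha (by simpa using hy.pow m) hb with h | h
      · simpa using h.1
      · omega
    let P : Submodule K (homogeneousSubmodule σ K j × homogeneousSubmodule σ K (j - m)) :=
      (J.restrictScalars K).comap
        ((homogeneousSubmodule σ K j).subtype.comp (LinearMap.fst K _ _) -
          (LinearMap.mulLeft K (y ^ m)).comp
            ((homogeneousSubmodule σ K (j - m)).subtype.comp (LinearMap.snd K _ _)))
    obtain ⟨β, hβ⟩ := exists_linearMap_of_relation P (by
      rintro ⟨a, ha⟩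
      obtain ⟨q, hq⟩ := h j m hjm a ha
      rcases exists_homogeneous_factor hJ ha (by simpa using hy.pow m) hq with h | h
      · omega
      · obtain ⟨_, q', hq', hq''⟩ := h
        exact ⟨⟨q', hq'⟩, hq''⟩)
    have hhom : ∀ i, i ≤ m → (C (m.choose i : K) * (w ^ i * y ^ (m - i))).IsHomogeneous m := by
      intro i hi
      refine IsHomogeneous.C_mul ?_ _
      have := (hw.pow i).mul (hy.pow (m - i))
      rwa [one_mul, one_mul, Nat.add_sub_cancel' hi] at this
    -- `a ↦ a + ((y + s w) ^ m - y ^ m) β(a)`, expanded in powers of `s`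
    let A : ℕ → Module.End K (homogeneousSubmodule σ K j) := fun i =>
      if hi : 1 ≤ i ∧ i ≤ m then
        ((LinearMap.mulLeft K (C (m.choose i : K) * (w ^ i * y ^ (m - i)))).comp
          ((homogeneousSubmodule σ K (j - m)).subtype.comp β)).codRestrict _ (fun a => by
            have := (hhom i hi.2).mul (β a).2
            rwa [Nat.add_sub_cancel' hmj] at this)
      else 1
    refine (eventually_surjective_sum_pow_smul m A (by simp [A])).mono ?_
    intro s hs a ha
    obtain ⟨a', ha'⟩ := hs ⟨a, ha⟩
    refine ⟨β a', ?_⟩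
    have hval : a = (a' : MvPolynomial σ K) +
        ((y + C s * w) ^ m - y ^ m) * (β a' : MvPolynomial σ K) := by
      have h1 : _ = a := congrArg Subtype.val ha'
      rw [← h1, add_comm y, add_pow, Finset.sum_range_succ', Finset.sum_range_succ']
      simp only [A, pow_zero, one_smul, LinearMap.add_apply, LinearMap.sum_apply,
        Submodule.coe_add, Submodule.coe_sum]
      rw [add_comm]
      congr 1
      simp only [one_mul, Nat.sub_zero, Nat.choose_zero_right, Nat.cast_one, mul_one,
        add_sub_cancel_right, Finset.sum_mul]
      refine Finset.sum_congr rfl fun i hi => ?_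
      rw [dif_pos ⟨by omega, by have := Finset.mem_range.mp hi; omega⟩]
      simp [smul_eq_C_mul, mul_pow]
      ring
    have : a - (y + C s * w) ^ m * (β a' : MvPolynomial σ K) =
        (a' : MvPolynomial σ K) - y ^ m * (β a' : MvPolynomial σ K) := by
      rw [hval]; ring
    rw [this]
    exact hβ a'
  have hfin : ∀ᶠ s : K in Filter.cofinite, ∀ j ∈ Finset.range (c + 2), c ≤ 2 * j →
      ∀ a : MvPolynomial σ K, a.IsHomogeneous j → ∃ b, a - (y + C s * w) ^ (2 * j - c) * b ∈ J := by
    refine (Filter.eventually_all_finset _).mpr fun j _ => ?_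
    by_cases hc : c ≤ 2 * j
    · filter_upwards [key j (2 * j - c) (by omega)] with s hs _ using hs
    · exact Filter.Eventually.of_forall fun s h => absurd h hc
  refine hfin.mono fun s hs => LefschetzSurjective.of_le hJ (hy.add (hw.C_mul s)) ?_
  intro j m hj hjm a ha
  obtain rfl : m = 2 * j - c := by omega
  exact hs j (Finset.mem_range.mpr (by omega)) (by omega) a ha

lemma LefschetzSurjective.genericLinear [Finite σ] (hJ : IsHomogeneousIdeal J)
    {y : MvPolynomial σ K} (hy : y.IsHomogeneous 1) (h : LefschetzSurjective J c y) :
    GenericLinear (LefschetzSurjective J c) :=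
  ⟨_, fun _ _ h => h, ⟨y, hy, h⟩, fun _ _ hy hw h => h.eventually hJ hy hw⟩

end Lefschetz

/-! ### From central simple modules to the whole algebra -/

section CentralSimple

variable {σ K : Type*} [Field K] {J : Ideal (MvPolynomial σ K)} {c : ℕ} {y z : MvPolynomial σ K}

/-- The ideal of `R[T]`, where `R = K[σ]`, which defines the associated graded ring of `R / J` for
the `z`-adic filtration, with `T` in the role of the initial form of `z`: its elements have
`q`-th coefficient in `z R + (J : z ^ q)` for all `q`. -/
def initialIdeal (J : Ideal (MvPolynomial σ K)) (z : MvPolynomial σ K) :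
    Ideal (Polynomial (MvPolynomial σ K)) where
  carrier := {p | ∀ q, ∃ g h, z ^ q * h ∈ J ∧ p.coeff q = z * g + h}
  zero_mem' q := ⟨0, 0, by simp, by simp⟩
  add_mem' := by
    intro p p' hp hp' q
    obtain ⟨g, h, hh, e⟩ := hp q
    obtain ⟨g', h', hh', e'⟩ := hp' q
    refine ⟨g + g', h + h', ?_, ?_⟩
    · rw [mul_add]; exact add_mem hh hh'
    · rw [Polynomial.coeff_add, e, e']; ring
  smul_mem' := by
    intro r p hp q
    choose g h hh e using hp
    refine ⟨∑ x ∈ Finset.HasAntidiagonal.antidiagonal q, r.coeff x.1 * g x.2,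
      ∑ x ∈ Finset.HasAntidiagonal.antidiagonal q, r.coeff x.1 * h x.2, ?_, ?_⟩
    · rw [Finset.mul_sum]
      refine sum_mem fun x hx => ?_
      rw [← Finset.HasAntidiagonal.mem_antidiagonal.mp hx, pow_add]
      convert J.mul_mem_left (z ^ x.1 * r.coeff x.1) (hh x.2) using 1
      ring
    · rw [smul_eq_mul, Polynomial.coeff_mul, Finset.mul_sum, ← Finset.sum_add_distrib]
      refine Finset.sum_congr rfl fun x _ => ?_
      rw [e]; ring

lemma C_mul_X_pow_mem_initialIdeal {a g h : MvPolynomial σ K} {k : ℕ} (hh : z ^ k * h ∈ J)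
    (ha : a = z * g + h) : Polynomial.C a * Polynomial.X ^ k ∈ initialIdeal J z := by
  intro q
  rw [Polynomial.coeff_C_mul, Polynomial.coeff_X_pow]
  by_cases hq : q = k
  · subst hq
    exact ⟨g, h, hh, by simp [ha]⟩
  · exact ⟨0, 0, by simp, by simp [hq]⟩

/-- The elements provided by `CentralSimpleLefschetz` can be taken homogeneous. -/
lemma CentralSimpleLefschetz.exists_homogeneous (hJ : IsHomogeneousIdeal J)
    (hz : z.IsHomogeneous 1) (hy : y.IsHomogeneous 1) (H : CentralSimpleLefschetz J z c y)
    {f j m : ℕ} (hjm : 2 * j + f = c + m) {a : MvPolynomial σ K} (ha : a.IsHomogeneous j)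
    (hza : z ^ (f + 1) * a ∈ J) :
    ∃ b g h, z ^ (f + 1) * b ∈ J ∧ (b = 0 ∨ m ≤ j ∧ b.IsHomogeneous (j - m)) ∧
      z ^ f * h ∈ J ∧ h.IsHomogeneous j ∧ a = y ^ m * b + z * g + h := by
  obtain ⟨b, g, h, hb, hh, e⟩ := H f j m hjm a ha hza
  have hzf : ∀ f, (z ^ f).IsHomogeneous f := fun f => by simpa using hz.pow f
  have hym : (y ^ m).IsHomogeneous m := by simpa using hy.pow m
  have hcomp : ∀ {f i : ℕ} {p : MvPolynomial σ K}, z ^ f * p ∈ J →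
      z ^ f * homogeneousComponent i p ∈ J := by
    intro f i p hp
    have := hJ _ hp (f + i)
    rwa [homogeneousComponent_mul_of_le (hzf f) (by omega), Nat.add_sub_cancel_left] at this
  have hg : ∃ g', homogeneousComponent j (z * g) = z * g' := by
    rcases lt_or_ge j 1 with h1 | h1
    · exact ⟨0, by rw [homogeneousComponent_mul_of_lt hz h1, mul_zero]⟩
    · exact ⟨_, homogeneousComponent_mul_of_le hz h1⟩
  obtain ⟨g', hg'⟩ := hg
  have e' := congrArg (homogeneousComponent j) e
  rw [homogeneousComponent_eq_self ha, map_add, map_add, hg'] at e'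
  rcases lt_or_ge j m with hmj | hmj
  · rw [homogeneousComponent_mul_of_lt hym hmj] at e'
    exact ⟨0, g', _, by simp, Or.inl rfl, hcomp hh, homogeneousComponent_isHomogeneous _ _,
      by rw [e', mul_zero]⟩
  · rw [homogeneousComponent_mul_of_le hym hmj] at e'
    exact ⟨_, g', _, hcomp hb, Or.inr ⟨hmj, homogeneousComponent_isHomogeneous _ _⟩,
      hcomp hh, homogeneousComponent_isHomogeneous _ _, e'⟩

/-- In the associated graded ring, all elements `y ^ s * a * T ^ k` of degree `j` with
`z ^ f * a = 0` are multiples of `(y + T) ^ m`, where `2 * j = c + m`. By induction on `f` this is a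
statement on the tensor product of a central simple module with `K[T] / (T ^ f)`. Elements above
the middle degree of the central simple module are multiples of powers of `y`; an element below it
is, up to a multiple of `y`, primitive, that is, killed by the right power of `y`, and for primitive
elements the claim is the one on monomials in two variables. -/
lemma CentralSimpleLefschetz.mem_span_sup_initialIdeal [CharZero K] (hJ : IsHomogeneousIdeal J)
    (hz : z.IsHomogeneous 1) (hy : y.IsHomogeneous 1) (H : CentralSimpleLefschetz J z c y)
    {j m : ℕ} (hjm : 2 * j = c + m) :
    ∀ (f i : ℕ) (a : MvPolynomial σ K), a.IsHomogeneous i → z ^ f * a ∈ J →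
      ∀ s k, i + s + k = j → Polynomial.C (y ^ s * a) * Polynomial.X ^ k ∈
        Ideal.span {(Polynomial.C y + Polynomial.X) ^ m} ⊔ initialIdeal J z := by
  intro f
  induction f with
  | zero =>
    intro i a _ ha s k _
    rw [pow_zero, one_mul] at ha
    exact Ideal.mem_sup_right (C_mul_X_pow_mem_initialIdeal (g := 0)
      (J.mul_mem_left _ (J.mul_mem_left _ ha)) (by rw [mul_zero, zero_add]))
  | succ f ihf =>
    intro i
    induction i using Nat.strong_induction_on with
    | _ i ihi =>
    intro a ha hza s k hsk
    rcases lt_or_ge c (2 * i + f) with hci | hci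
    · obtain ⟨m', hm'⟩ := Nat.exists_eq_add_of_lt hci
      obtain ⟨b, g, h, hb, hb', hh, hh', e⟩ :=
        H.exists_homogeneous hJ hz hy (m := m' + 1) (by omega) ha hza
      have e' : Polynomial.C (y ^ s * a) * Polynomial.X ^ k =
          Polynomial.C (y ^ (s + (m' + 1)) * b) * Polynomial.X ^ k +
          Polynomial.C (z * (y ^ s * g) + 0) * Polynomial.X ^ k +
          Polynomial.C (y ^ s * h) * Polynomial.X ^ k := by
        rw [← add_mul, ← add_mul, ← map_add, ← map_add, e]
        ring_nf
      rw [e']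
      refine add_mem (add_mem ?_ (Ideal.mem_sup_right
        (C_mul_X_pow_mem_initialIdeal (by simp) rfl))) (ihf i h hh' hh s k hsk)
      rcases hb' with rfl | ⟨hle, hb'⟩
      · simp
      · exact ihi _ (by omega) b hb' hb _ _ (by omega)
    · obtain ⟨r, hr⟩ := Nat.exists_eq_add_of_le hci
      have hya : (y ^ (r + 1) * a).IsHomogeneous (i + (r + 1)) := by
        rw [add_comm i]
        simpa only [one_mul] using (hy.pow (r + 1)).mul ha
      obtain ⟨u, g, h, hu, hu', hh, hh', e⟩ :=
        H.exists_homogeneous hJ hz hy (m := r + 2) (f := f) (by omega) hya (by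
          rw [mul_left_comm]; exact J.mul_mem_left _ hza)
      -- the primitive part of `a`
      have hp : (a - y * u).IsHomogeneous i := by
        refine ha.sub ?_
        rcases hu' with rfl | ⟨hle, hu'⟩
        · rw [mul_zero]; exact isHomogeneous_zero _ _ _
        · have := hy.mul hu'
          rwa [show 1 + (i + (r + 1) - (r + 2)) = i by omega] at this
      have hzp : z ^ (f + 1) * (a - y * u) ∈ J := by
        rw [mul_sub, mul_left_comm _ y]
        exact sub_mem hza (J.mul_mem_left _ hu)
      have hyp : y ^ (r + 1) * (a - y * u) = z * g + h := by
        linear_combination e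
      have hprim := forall_mem_of_binomial_relations
        ((Ideal.span {(Polynomial.C y + Polynomial.X) ^ m} ⊔ initialIdeal J z).restrictScalars K)
        (fun s => Polynomial.C (y ^ s * (a - y * u)) * Polynomial.X ^ (j - i - s))
        (D := j - i) (κ := r + 1) (f := f + 1) (m := m) (by omega)
        (by
          intro s hs hκ
          obtain ⟨s', rfl⟩ := Nat.exists_eq_add_of_le hκ
          have e' : Polynomial.C (y ^ (r + 1 + s') * (a - y * u)) *
                Polynomial.X ^ (j - i - (r + 1 + s')) =
              Polynomial.C (z * (y ^ s' * g) + 0) * Polynomial.X ^ (j - i - (r + 1 + s')) +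
              Polynomial.C (y ^ s' * h) * Polynomial.X ^ (j - i - (r + 1 + s')) := by
            rw [← add_mul, ← map_add, pow_add, mul_right_comm, hyp]
            ring_nf
          rw [Submodule.restrictScalars_mem, e']
          exact add_mem (Ideal.mem_sup_right (C_mul_X_pow_mem_initialIdeal (by simp) rfl))
            (ihf _ h hh' hh _ _ (by omega)))
        (by
          intro s hs hT
          obtain ⟨q, hq⟩ := Nat.exists_eq_add_of_le (show f + 1 ≤ j - i - s by omega)
          refine Ideal.mem_sup_right (C_mul_X_pow_mem_initialIdeal (g := 0) ?_
            (by rw [mul_zero, zero_add]))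
          rw [hq, pow_add]
          convert J.mul_mem_left (z ^ q * y ^ s) hzp using 1
          ring)
        (by
          intro s hs
          rw [Submodule.restrictScalars_mem]
          refine Ideal.mem_sup_left (Ideal.mem_span_singleton.mpr
            ⟨Polynomial.C (y ^ s * (a - y * u)) * Polynomial.X ^ (j - i - s - m), ?_⟩)
          rw [add_pow, Finset.sum_mul]
          refine Finset.sum_congr rfl fun x hx => ?_
          have hx : x ≤ m := by have := Finset.mem_range.mp hx; omega
          have hX : j - i - (s + x) = (m - x) + (j - i - s - m) := by omega
          rw [hX, pow_add Polynomial.X, pow_add y, nsmul_eq_mul]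
          simp only [map_mul, map_pow]
          ring)
        s (by omega)
      have e' : Polynomial.C (y ^ s * a) * Polynomial.X ^ k =
          Polynomial.C (y ^ s * (a - y * u)) * Polynomial.X ^ (j - i - s) +
          Polynomial.C (y ^ (s + 1) * u) * Polynomial.X ^ k := by
        rw [show j - i - s = k by omega, ← add_mul, ← map_add]
        ring_nf
      rw [e']
      refine add_mem hprim ?_
      rcases hu' with rfl | ⟨hle, hu'⟩
      · simp
      · exact ihi _ (by omega) u hu' hu _ _ (by omega)

/-- The linear map `ξ ↦ ∑ₖ t⁻ᵏ zᵏ ξₖ` on families of forms `ξₖ` of degree `j - k`. -/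
noncomputable def adicSum (z : MvPolynomial σ K) (j : ℕ) (t : K) :
    ((k : Fin (j + 1)) → homogeneousSubmodule σ K (j - k)) →ₗ[K] MvPolynomial σ K :=
  ∑ k : Fin (j + 1), (LinearMap.mulLeft K ((C t⁻¹ * z) ^ (k : ℕ))).comp
    ((homogeneousSubmodule σ K (j - k)).subtype.comp (LinearMap.proj k))

lemma adicSum_apply (j : ℕ) (t : K) (ξ : (k : Fin (j + 1)) → homogeneousSubmodule σ K (j - k)) :
    adicSum z j t ξ = ∑ k : Fin (j + 1), (C t⁻¹ * z) ^ (k : ℕ) * (ξ k : MvPolynomial σ K) := by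
  simp [adicSum, LinearMap.sum_apply]

lemma adicSum_single (j : ℕ) (t : K) (k : Fin (j + 1)) (a : homogeneousSubmodule σ K (j - k)) :
    adicSum z j t (Pi.single k a) = (C t⁻¹ * z) ^ (k : ℕ) * (a : MvPolynomial σ K) := by
  rw [adicSum_apply, Finset.sum_eq_single k]
  · rw [Pi.single_eq_same]
  · intro i _ hi
    rw [Pi.single_eq_of_ne hi]
    simp
  · simp

/-- A congruence `(y + T) ^ m * b ≡ a * T ^ k` in the associated graded ring, specialised at
`T = z / t`: modulo `J` and the multiples of `(z + t y) ^ m`, the element `a (z / t) ^ k` is `t`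
times a combination of higher powers of `z / t` whose coefficients do not depend on `t`. -/
lemma exists_adicSum_sub_mem (hJ : IsHomogeneousIdeal J) (hz : z.IsHomogeneous 1)
    (hy : y.IsHomogeneous 1) {j m : ℕ} (k : Fin (j + 1)) (a : homogeneousSubmodule σ K (j - k))
    (h : Polynomial.C (a : MvPolynomial σ K) * Polynomial.X ^ (k : ℕ) ∈
      Ideal.span {(Polynomial.C y + Polynomial.X) ^ m} ⊔ initialIdeal J z) :
    ∃ η : (k : Fin (j + 1)) → homogeneousSubmodule σ K (j - k), ∀ t : K, t ≠ 0 →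
      adicSum z j t (Pi.single k a) - t • adicSum z j t η ∈
        Ideal.span {(z + C t * y) ^ m} ⊔ J := by
  obtain ⟨p, hp, ν, hν, e⟩ := Submodule.mem_sup.mp h
  obtain ⟨b, rfl⟩ := Ideal.mem_span_singleton.mp hp
  choose g hh hhJ hg using hν
  let F : ℕ → MvPolynomial σ K := fun q =>
    if q = 0 then 0 else homogeneousComponent (j - q) (g (q - 1))
  have hF : ∀ q, F q ∈ homogeneousSubmodule σ K (j - q) := by
    intro q
    by_cases hq : q = 0
    · simp only [F, if_pos hq]; exact zero_mem _
    · simp only [F, if_neg hq]; exact homogeneousComponent_mem _ _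
  refine ⟨fun q => ⟨F q, hF q⟩, ?_⟩
  intro t ht
  set T : MvPolynomial σ K := C t⁻¹ * z with hT
  have hT1 : ∀ q, (T ^ q).IsHomogeneous q := fun q => by simpa using (hz.C_mul t⁻¹).pow q
  have hL1 : ((y + T) ^ m).IsHomogeneous m := by
    simpa using (hy.add (hz.C_mul t⁻¹)).pow m
  have hLL : (y + T) ^ m = C (t⁻¹ ^ m) * (z + C t * y) ^ m := by
    rw [C_pow, ← mul_pow, mul_add, ← mul_assoc, ← C_mul, inv_mul_cancel₀ ht, C_1, one_mul, hT,
      add_comm]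
  -- evaluate at `T`, and take the component of degree `j`
  let N := ν.natDegree + j + 1
  have e1 := congrArg (fun p => homogeneousComponent j (Polynomial.eval T p)) e
  have hν' : Polynomial.eval T ν = ∑ q ∈ Finset.range N, (T ^ q * (z * g q) + T ^ q * hh q) := by
    rw [Polynomial.eval_eq_sum_range' (n := N) (by omega)]
    refine Finset.sum_congr rfl fun q _ => ?_
    rw [hg]; ring
  have ha : ((a : MvPolynomial σ K) * T ^ (k : ℕ)).IsHomogeneous j := by
    have := a.2.mul (hT1 k)
    rwa [Nat.sub_add_cancel (by omega)] at this
  simp only [Polynomial.eval_add, Polynomial.eval_mul, Polynomial.eval_pow, Polynomial.eval_C,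
    Polynomial.eval_X, map_add, hν', Finset.sum_add_distrib, homogeneousComponent_eq_self ha] at e1
  have m1 : homogeneousComponent j ((y + T) ^ m * b.eval T) ∈
      Ideal.span {(z + C t * y) ^ m} ⊔ J := by
    rcases lt_or_ge j m with hm | hm
    · rw [homogeneousComponent_mul_of_lt hL1 hm]; exact zero_mem _
    · rw [homogeneousComponent_mul_of_le hL1 hm, hLL]
      exact Ideal.mem_sup_left (Ideal.mul_mem_right _ _ (Ideal.mul_mem_left _ _
        (Ideal.mem_span_singleton_self _)))
  have m2 : homogeneousComponent j (∑ q ∈ Finset.range N, T ^ q * hh q) ∈ J := by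
    refine hJ _ (sum_mem fun q _ => ?_) j
    rw [hT, mul_pow, mul_assoc]
    exact J.mul_mem_left _ (hhJ q)
  have m3 : homogeneousComponent j (∑ q ∈ Finset.range N, T ^ q * (z * g q)) =
      t • adicSum z j t (fun q => ⟨F q, hF q⟩) := by
    rw [adicSum_apply, ← Finset.sum_range (fun q => (C t⁻¹ * z) ^ q * F q),
      Finset.sum_range_succ' _ j, map_sum,
      smul_eq_C_mul]
    simp only [F, if_pos, mul_zero, add_zero, Nat.add_one_ne_zero, if_false, Nat.add_sub_cancel]
    rw [Finset.mul_sum]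
    have hterm : ∀ q, T ^ q * (z * g q) = T ^ (q + 1) * (C t * g q) := by
      intro q
      have : T * C t = z := by
        rw [hT, mul_right_comm, ← C_mul, inv_mul_cancel₀ ht, C_1, one_mul]
      rw [← this]; ring
    symm
    refine Finset.sum_subset_zero_on_sdiff (Finset.range_subset_range.mpr (by omega)) ?_ ?_
    · intro q hq
      simp only [Finset.mem_sdiff, Finset.mem_range, not_lt] at hq
      rw [hterm, homogeneousComponent_mul_of_lt (hT1 _) (by omega)]
    · intro q hq
      rw [Finset.mem_range] at hq
      rw [hterm, homogeneousComponent_mul_of_le (hT1 _) (by omega), homogeneousComponent_C_mul]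
      ring
  rw [adicSum_single, ← m3]
  have : (C t⁻¹ * z) ^ (k : ℕ) * (a : MvPolynomial σ K) = (a : MvPolynomial σ K) * T ^ (k : ℕ) :=
    mul_comm _ _
  rw [this, ← e1]
  convert add_mem m1 (Ideal.mem_sup_right m2) using 1
  ring

/-- If some `y` has surjective Lefschetz maps on all central simple modules of `(K[σ] / J, z)`, then
some linear form, namely `z + t * y` for suitable `t ≠ 0`, has them on `K[σ] / J`. -/
lemma CentralSimpleLefschetz.exists_lefschetzSurjective [CharZero K] [Finite σ]
    (hJ : IsHomogeneousIdeal J) (hz : z.IsHomogeneous 1) (hy : y.IsHomogeneous 1)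
    (hnil : ∃ N, z ^ N ∈ J) (H : CentralSimpleLefschetz J z c y) :
    ∃ L : MvPolynomial σ K, L.IsHomogeneous 1 ∧ LefschetzSurjective J c L := by
  have key : ∀ j m : ℕ, 2 * j = c + m → ∀ᶠ t : K in Filter.cofinite, t ≠ 0 →
      ∀ a : MvPolynomial σ K, a.IsHomogeneous j → a ∈ Ideal.span {(z + C t * y) ^ m} ⊔ J := by
    intro j m hjm
    let P : Submodule K (((k : Fin (j + 1)) → homogeneousSubmodule σ K (j - k)) ×
        ((k : Fin (j + 1)) → homogeneousSubmodule σ K (j - k))) :=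
      ⨅ t : K, ⨅ _ : t ≠ 0, ((Ideal.span {(z + C t * y) ^ m} ⊔ J).restrictScalars K).comap
        ((adicSum z j t).comp (LinearMap.fst K _ _) -
          t • (adicSum z j t).comp (LinearMap.snd K _ _))
    have hPmem : ∀ ξ η, (ξ, η) ∈ P ↔ ∀ t : K, t ≠ 0 →
        adicSum z j t ξ - t • adicSum z j t η ∈ Ideal.span {(z + C t * y) ^ m} ⊔ J := by
      intro ξ η
      simp only [P, Submodule.mem_iInf]
      rfl
    obtain ⟨M, hM⟩ := exists_linearMap_of_relation P (by
      intro ξ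
      have hs : ∀ k, ∃ η, (Pi.single k (ξ k), η) ∈ P := by
        intro k
        obtain ⟨N, hN⟩ := hnil
        have := H.mem_span_sup_initialIdeal hJ hz hy hjm N (j - k) (ξ k) (ξ k).2
          (J.mul_mem_right _ hN) 0 k (by omega)
        rw [pow_zero, one_mul] at this
        obtain ⟨η, hη⟩ := exists_adicSum_sub_mem hJ hz hy k (ξ k) this
        exact ⟨η, (hPmem _ _).mpr hη⟩
      choose η hη using hs
      refine ⟨∑ k, η k, ?_⟩
      have := P.sum_mem (t := Finset.univ) fun k _ => hη k
      have e : (ξ, ∑ k, η k) = ∑ k, (Pi.single k (ξ k), η k) :=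
        Prod.ext (by rw [Prod.fst_sum, Finset.univ_sum_single]) (by rw [Prod.snd_sum])
      rwa [e])
    have hev := eventually_surjective_sum_pow_smul (K := K) 1 (fun i => if i = 0 then 1 else -M)
      (by simp)
    refine hev.mono fun t ht ht0 a ha => ?_
    obtain ⟨ξ, hξ⟩ := ht (Pi.single 0 ⟨a, ha⟩)
    have h1 := (hPmem _ _).mp (hM ξ) t ht0
    have h2 : ξ - t • M ξ = Pi.single 0 ⟨a, ha⟩ := by
      rw [← hξ]
      simp [Finset.sum_range_succ, sub_eq_add_neg]
    rw [← map_smul, ← map_sub, h2, adicSum_single] at h1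
    simpa using h1
  have hfin : ∀ᶠ t : K in Filter.cofinite, t ≠ 0 ∧ ∀ j ∈ Finset.range (c + 2), c ≤ 2 * j → t ≠ 0 →
      ∀ a : MvPolynomial σ K, a.IsHomogeneous j →
        a ∈ Ideal.span {(z + C t * y) ^ (2 * j - c)} ⊔ J := by
    refine (Filter.eventually_cofinite_ne 0).and
      ((Filter.eventually_all_finset _).mpr fun j _ => ?_)
    by_cases hc : c ≤ 2 * j
    · filter_upwards [key j (2 * j - c) (by omega)] with s hs _ using hs
    · exact Filter.Eventually.of_forall fun s h => absurd h hc
  obtain ⟨t, ht0, ht⟩ := hfin.exists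
  have hL : (z + C t * y).IsHomogeneous 1 := hz.add (hy.C_mul t)
  refine ⟨_, hL, LefschetzSurjective.of_le hJ hL ?_⟩
  intro j m hj hjm a ha
  obtain rfl : m = 2 * j - c := by omega
  obtain ⟨p, hp, q, hq, e⟩ := Submodule.mem_sup.mp
    (ht j (Finset.mem_range.mpr (by omega)) (by omega) ht0 a ha)
  obtain ⟨b, rfl⟩ := Ideal.mem_span_singleton.mp hp
  exact ⟨b, by rw [← e, add_sub_cancel_left]; exact hq⟩

end CentralSimple

/-! ### Products of linear forms without common zeros -/

lemma Ideal.mem_of_pow_mul_mem {R : Type*} [CommRing R] {I : Ideal R} {w : R}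
    (hw : ∀ a, w * a ∈ I → a ∈ I) (e : ℕ) {a : R} (ha : w ^ e * a ∈ I) : a ∈ I := by
  induction e with
  | zero => simpa using ha
  | succ e ih =>
    rw [pow_succ', mul_assoc] at ha
    exact ih (hw _ ha)

section LinearProducts

variable {K : Type*} [Field K] {n : ℕ}

lemma exists_coeff_of_isHomogeneous_one {p : MvPolynomial (Fin n) K} (hp : p.IsHomogeneous 1) :
    ∃ r : Fin n → K, p = ∑ j, C (r j) * X j := by
  have : p ∈ homogeneousSubmodule (Fin n) K 1 := hp
  rw [homogeneousSubmodule_one_eq_span_X, Submodule.mem_span_range_iff_exists_fun] at this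
  obtain ⟨r, hr⟩ := this
  exact ⟨r, by simp_rw [← hr, smul_eq_C_mul]⟩

/-- The only common zero in `Kⁿ` of the polynomials `f i` is the origin. -/
def OnlyTrivialZero (f : Fin n → MvPolynomial (Fin n) K) : Prop :=
  ∀ v : Fin n → K, (∀ i, eval v (f i) = 0) → v = 0

lemma X_mul_mem_span_X_image {S : Set (Fin n)} {i : Fin n} (hi : i ∉ S)
    {a : MvPolynomial (Fin n) K} (h : X i * a ∈ Ideal.span (X '' S)) : a ∈ Ideal.span (X '' S) := by
  rw [mem_ideal_span_X_image] at h ⊢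
  intro m hm
  obtain ⟨i', hi', hne⟩ := h (Finsupp.single i 1 + m) (by
    rw [mem_support_iff, coeff_X_mul]
    exact mem_support_iff.mp hm)
  refine ⟨i', hi', ?_⟩
  have : i ≠ i' := fun h => hi (h ▸ hi')
  simpa [Finsupp.single_apply, this] using hne

/-- Linear forms in general position are regular modulo each other: after a linear change of
coordinates they are the variables. -/
lemma linear_mul_mem_span_image {f : Fin n → MvPolynomial (Fin n) K}
    (hf : ∀ i, (f i).IsHomogeneous 1) (hZ : OnlyTrivialZero f) {S : Set (Fin n)} {i : Fin n}
    (hi : i ∉ S) {a : MvPolynomial (Fin n) K} (h : f i * a ∈ Ideal.span (f '' S)) :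
    a ∈ Ideal.span (f '' S) := by
  choose r hr using fun i => exists_coeff_of_isHomogeneous_one (hf i)
  let A : Matrix (Fin n) (Fin n) K := r
  have hA : IsUnit A := by
    rw [← Matrix.mulVec_injective_iff_isUnit, ← Matrix.coe_mulVecLin,
      ← LinearMap.ker_eq_bot, LinearMap.ker_eq_bot']
    intro v hv
    refine hZ v fun i => ?_
    rw [hr i]
    simpa [Matrix.mulVec, dotProduct] using congrFun hv i
  obtain ⟨⟨A', B, hAB, hBA⟩, rfl : A' = A⟩ := hA
  let φ : MvPolynomial (Fin n) K →ₐ[K] MvPolynomial (Fin n) K :=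
    aeval fun j => ∑ i, C (B j i) * X i
  let ψ : MvPolynomial (Fin n) K →ₐ[K] MvPolynomial (Fin n) K := aeval f
  have hcomb : ∀ (M N : Matrix (Fin n) (Fin n) K), M * N = 1 →
      ∀ j, ∑ i, C (M j i) * ∑ i', C (N i i') * X i' = (X j : MvPolynomial (Fin n) K) := by
    intro M N hMN j
    simp_rw [Finset.mul_sum]
    rw [Finset.sum_comm]
    simp_rw [← mul_assoc, ← C_mul, ← Finset.sum_mul, ← map_sum]
    have : ∀ i', ∑ i, M j i * N i i' = (1 : Matrix (Fin n) (Fin n) K) j i' := by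
      intro i'
      rw [← hMN, Matrix.mul_apply]
    simp [this, Matrix.one_apply]
  have hφ : ∀ i, φ (f i) = X i := by
    intro i
    rw [hr i, map_sum]
    simp only [φ, map_mul, aeval_X, algHom_C, algebraMap_eq]
    exact hcomb A' B hAB i
  have hψφ : ∀ p, ψ (φ p) = p := by
    intro p
    have : ψ.comp φ = AlgHom.id K _ := by
      ext1 j
      simp only [φ, ψ, AlgHom.comp_apply, aeval_X, map_sum, map_mul, algHom_C, algebraMap_eq,
        AlgHom.id_apply]
      simp_rw [hr]
      exact hcomb B A' hBA j
    exact DFunLike.congr_fun this p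
  have h1 := Ideal.mem_map_of_mem φ h
  rw [Ideal.map_span, ← Set.image_comp, map_mul, hφ] at h1
  have hφf : (⇑φ ∘ f) '' S = X '' S := Set.image_congr fun i _ => hφ i
  rw [hφf] at h1
  have h2 := Ideal.mem_map_of_mem ψ (X_mul_mem_span_X_image hi h1)
  rw [hψφ, Ideal.map_span, ← Set.image_comp] at h2
  have hψf : (⇑ψ ∘ X) '' S = f '' S := Set.image_congr fun i _ => by simp [ψ]
  rwa [hψf] at h2

/-- If `n` products of linear forms in `n` variables have no common zero but the origin, then any
linear form among them is regular modulo any of the others. The induction splits a product `p * q`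
with `p` linear, and uses the exact sequence
`0 → R / (N, q) → R / (N, p q) → R / (N, p) → 0`. -/
lemma linear_mul_mem_span_prod_image (N : ℕ) :
    ∀ (g : Fin n → List (MvPolynomial (Fin n) K)), ∑ i, (g i).length ≤ N →
      (∀ i, ∀ w ∈ g i, w.IsHomogeneous 1) → OnlyTrivialZero (fun i => (g i).prod) →
      ∀ (S : Set (Fin n)), (∀ i ∉ S, (g i).length = 1) → ∀ i ∉ S, ∀ a,
        (g i).prod * a ∈ Ideal.span ((fun i => (g i).prod) '' S) →
        a ∈ Ideal.span ((fun i => (g i).prod) '' S) := by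
  induction N with
  | zero =>
    intro g hN _ _ S hS i hi
    have h1 : ∑ i, (g i).length = 0 := by omega
    rw [Finset.sum_eq_zero_iff] at h1
    have := hS i hi
    rw [h1 i (Finset.mem_univ i)] at this
    omega
  | succ N ih =>
    intro g hN hg hZ S hS i hi a ha
    by_cases hlin : ∀ i, (g i).length = 1
    · have hlin' : ∀ i, ((g i).prod).IsHomogeneous 1 := by
        intro i
        obtain ⟨w, hw⟩ := List.length_eq_one_iff.mp (hlin i)
        rw [hw, List.prod_singleton]
        exact hg i w (by simp [hw])
      exact linear_mul_mem_span_image hlin' hZ hi ha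
    push Not at hlin
    obtain ⟨k, hk⟩ := hlin
    have hkS : k ∈ S := by
      by_contra h
      exact hk (hS k h)
    rcases hgk : g k with _ | ⟨p, q⟩
    · have : (1 : MvPolynomial (Fin n) K) ∈ Ideal.span ((fun i => (g i).prod) '' S) :=
        Ideal.subset_span ⟨k, hkS, by simp [hgk]⟩
      rw [(Ideal.eq_top_iff_one _).mpr this]
      trivial
    have hq : q.length ≠ 0 := by
      intro h
      apply hk
      rw [hgk, List.length_cons, h]
    have hik : i ≠ k := fun h => hi (h ▸ hkS)
    have hSk : S = insert k (S \ {k}) := by simp [Set.insert_eq_of_mem hkS]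
    -- replacing the factor list of `k` by a proper nonempty part
    have hlen : ∀ L : List (MvPolynomial (Fin n) K), L.length < (g k).length →
        ∑ i, (Function.update g k L i).length ≤ N := by
      intro L hL
      have h1 : ∑ i, (Function.update g k L i).length < ∑ i, (g i).length := by
        refine Finset.sum_lt_sum (fun i _ => ?_) ⟨k, Finset.mem_univ k, by simpa using hL⟩
        by_cases h : i = k
        · subst h; simpa using hL.le
        · rw [Function.update_of_ne h]
      omega
    have hhom : ∀ L : List (MvPolynomial (Fin n) K), (∀ w ∈ L, w ∈ g k) →
        ∀ i, ∀ w ∈ Function.update g k L i, w.IsHomogeneous 1 := by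
      intro L hL i w hw
      by_cases h : i = k
      · subst h
        rw [Function.update_self] at hw
        exact hg _ w (hL w hw)
      · rw [Function.update_of_ne h] at hw
        exact hg i w hw
    have hzero : ∀ L : List (MvPolynomial (Fin n) K), L.prod ∣ (g k).prod →
        OnlyTrivialZero (fun i => (Function.update g k L i).prod) := by
      rintro L ⟨s, hs⟩ v hv
      refine hZ v fun i => ?_
      by_cases h : i = k
      · subst h
        have := hv i
        simp only [Function.update_self] at this
        simp [hs, this]
      · have := hv i
        simp only [Function.update_of_ne h] at this
        exact this
    have himg : ∀ L : List (MvPolynomial (Fin n) K),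
        (fun i => (Function.update g k L i).prod) '' (S \ {k}) =
          (fun i => (g i).prod) '' (S \ {k}) := by
      intro L
      refine Set.image_congr fun i hi => ?_
      rw [Function.update_of_ne hi.2]
    have hmem : ∀ (L : List (MvPolynomial (Fin n) K)) x,
        x ∈ Ideal.span ((fun i => (Function.update g k L i).prod) '' S) ↔
          ∃ r, ∃ y ∈ Ideal.span ((fun i => (g i).prod) '' (S \ {k})), x = r * L.prod + y := by
      intro L x
      rw [hSk, Set.image_insert_eq, Ideal.mem_span_insert, ← hSk, himg]
      simp
    have hmem' : ∀ x, x ∈ Ideal.span ((fun i => (g i).prod) '' S) ↔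
          ∃ r, ∃ y ∈ Ideal.span ((fun i => (g i).prod) '' (S \ {k})),
            x = r * (p * q.prod) + y := by
      intro x
      have := hmem (g k) x
      rwa [Function.update_eq_self, hgk, List.prod_cons] at this
    have hp1 : [p].length < (g k).length := by rw [hgk]; simp; omega
    have hq1 : q.length < (g k).length := by rw [hgk]; simp
    have hpdvd : [p].prod ∣ (g k).prod := by rw [hgk]; simp
    have hqdvd : q.prod ∣ (g k).prod := by rw [hgk]; simp
    have hpm : ∀ w ∈ [p], w ∈ g k := by rw [hgk]; simp
    have hqm : ∀ w ∈ q, w ∈ g k := by rw [hgk]; intro w hw; simp [hw]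
    have hsing : ∀ L, ∀ i ∉ S, (Function.update g k L i).length = 1 := by
      intro L i hi
      rw [Function.update_of_ne (fun h : i = k => hi (h ▸ hkS))]
      exact hS i hi
    have ihp := ih _ (hlen [p] hp1) (hhom [p] hpm) (hzero [p] hpdvd) S (hsing [p]) i hi
    have ihq := ih _ (hlen q hq1) (hhom q hqm) (hzero q hqdvd) S (hsing q) i hi
    have ihr := ih _ (hlen [p] hp1) (hhom [p] hpm) (hzero [p] hpdvd) (S \ {k}) (by
      intro i' hi'
      by_cases h : i' = k
      · subst h; simp
      · exact hsing _ i' fun h' => hi' ⟨h', h⟩) k (by simp)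
    rw [Function.update_of_ne hik] at ihp ihq
    rw [himg, Function.update_self, List.prod_singleton] at ihr
    obtain ⟨r, y, hy, e⟩ := (hmem' _).mp ha
    obtain ⟨b, y', hy', e'⟩ := (hmem [p] a).mp (ihp a ((hmem [p] _).mpr
      ⟨r * q.prod, y, hy, by rw [e, List.prod_singleton]; ring⟩))
    rw [List.prod_singleton] at e'
    have h3 : (g i).prod * b - r * q.prod ∈
        Ideal.span ((fun i => (g i).prod) '' (S \ {k})) := by
      refine ihr _ ?_
      have : p * ((g i).prod * b - r * q.prod) = y - (g i).prod * y' := by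
        rw [e'] at e
        linear_combination e
      rw [this]
      exact sub_mem hy (Ideal.mul_mem_left _ _ hy')
    obtain ⟨s, y'', hy'', e''⟩ := (hmem q b).mp (ihq b ((hmem q _).mpr
      ⟨r, _, h3, by ring⟩))
    refine (hmem' a).mpr ⟨s, y'' * p + y', add_mem (Ideal.mul_mem_right _ _ hy'') hy', ?_⟩
    rw [e', e'']; ring

/-- A product of linear forms. -/
def IsLinearProduct (f : MvPolynomial (Fin n) K) : Prop :=
  ∃ L : List (MvPolynomial (Fin n) K), (∀ w ∈ L, w.IsHomogeneous 1) ∧ f = L.prod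

lemma isLinearProduct_of_isHomogeneous {w : MvPolynomial (Fin n) K} (hw : w.IsHomogeneous 1) :
    IsLinearProduct w := ⟨[w], by simpa using hw, by simp⟩

lemma isLinearProduct_pow_mul {x l : MvPolynomial (Fin n) K} (hx : x.IsHomogeneous 1)
    (hl : l.IsHomogeneous 1) (e : ℕ) : IsLinearProduct (x ^ e * l) := by
  refine ⟨List.replicate e x ++ [l], ?_, by simp⟩
  intro w hw
  rw [List.mem_append, List.mem_singleton, List.mem_replicate] at hw
  rcases hw with ⟨_, rfl⟩ | rfl
  · exact hx
  · exact hl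

/-- Let `f` be a family of products of linear forms. If replacing `f k` by the linear form `w`
gives a family without nontrivial zeros, then `w` is regular modulo the `f i`, `i ≠ k`. -/
lemma mem_span_of_linear_mul_mem {f : Fin n → MvPolynomial (Fin n) K}
    (hf : ∀ i, IsLinearProduct (f i)) {k : Fin n} {w : MvPolynomial (Fin n) K}
    (hw : w.IsHomogeneous 1) (hZ : OnlyTrivialZero (Function.update f k w))
    {a : MvPolynomial (Fin n) K} (ha : w * a ∈ Ideal.span (f '' {k}ᶜ)) :
    a ∈ Ideal.span (f '' {k}ᶜ) := by
  choose g hg hfg using hf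
  have hprod : (fun i => (Function.update g k [w] i).prod) = Function.update f k w := by
    funext i
    by_cases h : i = k
    · subst h; simp
    · rw [Function.update_of_ne h, Function.update_of_ne h, hfg]
  have himg : (fun i => (Function.update g k [w] i).prod) '' {k}ᶜ = f '' {k}ᶜ := by
    rw [hprod]
    exact Set.image_congr fun i hi => Function.update_of_ne hi _ _
  have := linear_mul_mem_span_prod_image _ (Function.update g k [w]) le_rfl
    (by
      intro i v hv
      by_cases h : i = k
      · subst h
        rw [Function.update_self, List.mem_singleton] at hv
        exact hv ▸ hw
      · rw [Function.update_of_ne h] at hv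
        exact hg i v hv) (by rwa [hprod]) {k}ᶜ (by
      intro i hi
      obtain rfl : i = k := by simpa using hi
      simp) k (by simp) a
  rw [himg] at this
  simpa [ha] using this

lemma mem_span_range_update {f : Fin n → MvPolynomial (Fin n) K} {k : Fin n}
    {w x : MvPolynomial (Fin n) K} : x ∈ Ideal.span (Set.range (Function.update f k w)) ↔
      ∃ r, ∃ y ∈ Ideal.span (f '' {k}ᶜ), x = r * w + y := by
  have h1 : Set.range (Function.update f k w) = insert w (f '' {k}ᶜ) := by
    have hk : (Set.univ : Set (Fin n)) = insert k {k}ᶜ := by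
      ext i; simp [em]
    rw [← Set.image_univ, hk, Set.image_insert_eq, Function.update_self]
    congr 1
    exact Set.image_congr fun i hi => Function.update_of_ne hi _ _
  rw [h1, Ideal.mem_span_insert]

/-- Fewer than `n` linear forms in `n` variables have a common nontrivial zero. -/
lemma exists_ne_zero_forall_eval_eq_zero {w : Fin n → MvPolynomial (Fin n) K}
    (hw : ∀ i, (w i).IsHomogeneous 1) {k : Fin n} (hk : w k = 0) :
    ∃ v : Fin n → K, v ≠ 0 ∧ ∀ i, eval v (w i) = 0 := by
  choose r hr using fun i => exists_coeff_of_isHomogeneous_one (hw i)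
  let A : Matrix (Fin n) (Fin n) K := fun i j => if i = k then 0 else r i j
  obtain ⟨v, hv, hAv⟩ := Matrix.exists_mulVec_eq_zero_iff.mpr
    (Matrix.det_eq_zero_of_row_eq_zero (A := A) k (by simp [A]))
  refine ⟨v, hv, fun i => ?_⟩
  by_cases h : i = k
  · subst h; simp [hk]
  · have := congrFun hAv i
    rw [hr i]
    simpa [A, Matrix.mulVec, dotProduct, h] using this

end LinearProducts

/-! ### Operations on central simple modules -/

section CentralSimpleOperations

variable {σ K : Type*} [Field K] {J : Ideal (MvPolynomial σ K)} {c : ℕ} {y z : MvPolynomial σ K}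

/-- If `z = 0` in `A`, the only central simple module of `(A, z)` is `A` itself. -/
lemma CentralSimpleLefschetz.of_mem (hz : z ∈ J) (H : LefschetzSurjective J c y) :
    CentralSimpleLefschetz J z c y := by
  intro f j m hjm a ha _
  rcases f with _ | f
  · obtain ⟨b, hb⟩ := H j m hjm a ha
    exact ⟨b, 0, a - y ^ m * b, J.mul_mem_right _ (by simpa using hz), by simpa using hb, by ring⟩
  · refine ⟨0, 0, a, by simp, ?_, by simp⟩
    rw [pow_succ, mul_assoc]
    exact J.mul_mem_left _ (J.mul_mem_right _ hz)

/-- The central simple modules of `(A, z)` depend on `z` only up to a nonzero scalar. -/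
lemma CentralSimpleLefschetz.congr {x : MvPolynomial σ K} {γ : K} (hγ : γ ≠ 0)
    (hx : x - C γ * z ∈ J) (H : CentralSimpleLefschetz J x c y) :
    CentralSimpleLefschetz J z c y := by
  have key : ∀ f a, x ^ f * a ∈ J ↔ z ^ f * a ∈ J := by
    intro f a
    have h1 : x ^ f - (C γ * z) ^ f ∈ J :=
      J.mem_of_dvd (sub_dvd_pow_sub_pow _ _ f) hx
    have h2 : x ^ f * a - C (γ ^ f) * (z ^ f * a) ∈ J := by
      convert J.mul_mem_right a h1 using 1
      rw [mul_pow, C_pow]; ring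
    rw [← J.sub_mem_iff_left (y := x ^ f * a - C (γ ^ f) * (z ^ f * a)) h2, sub_sub_cancel]
    refine ⟨fun h => ?_, fun h => J.mul_mem_left _ h⟩
    convert J.mul_mem_left (C ((γ ^ f)⁻¹)) h using 1
    rw [← mul_assoc, ← C_mul, inv_mul_cancel₀ (pow_ne_zero f hγ), C_1, one_mul]
  intro f j m hjm a ha hza
  obtain ⟨b, g, h, hb, hh, e⟩ := H f j m hjm a ha ((key _ _).mpr hza)
  refine ⟨b, C γ * g, h + (x - C γ * z) * g, (key _ _).mp hb, ?_, by rw [e]; ring⟩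
  rw [mul_add]
  exact add_mem ((key _ _).mp hh) (J.mul_mem_left _ (J.mul_mem_right _ hx))

/-- The central simple modules of `z` on `A = R / (N, z ^ e * l)`, where `z` is regular modulo `N`.
Multiplication by `z ^ e` identifies `R / (N, l)` with an ideal of `A`, whose central simple modules
are those of `A` belonging to exponents greater than `e`; there are none for exponents less than
`e`, and the one for `e` is the ideal generated by `l` in `R / (N, z)`. -/
lemma CentralSimpleLefschetz.of_pow_mul {N : Ideal (MvPolynomial σ K)} {l : MvPolynomial σ K}
    {e cB : ℕ} {JB : Ideal (MvPolynomial σ K)}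
    (hJ : ∀ x, x ∈ J ↔ ∃ r, ∃ n ∈ N, x = r * (z ^ e * l) + n)
    (hJB : ∀ x, x ∈ JB ↔ ∃ r, ∃ n ∈ N, x = r * l + n)
    (hN : e ≠ 0 → ∀ a, z * a ∈ N → a ∈ N) (hc : c = cB + e)
    (HB : CentralSimpleLefschetz JB z cB y)
    (HU : e ≠ 0 → ∀ j m, 2 * j + (e - 1) = c + m → ∀ a : MvPolynomial σ K, a.IsHomogeneous j →
      a ∈ JB → ∃ b ∈ JB, ∃ g, ∃ n ∈ N, a = y ^ m * b + z * g + n) :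
    CentralSimpleLefschetz J z c y := by
  have hreg : ∀ s a, s ≤ e → z ^ s * a ∈ J → ∃ r, ∃ n ∈ N, a = r * (z ^ (e - s) * l) + n := by
    intro s a hs ha
    obtain ⟨r, n, hn, h⟩ := (hJ _).mp ha
    have hN' : ∀ b, z ^ s * b ∈ N → b ∈ N := by
      intro b hb
      rcases Nat.eq_zero_or_pos s with rfl | hs'
      · simpa using hb
      · exact Ideal.mem_of_pow_mul_mem (hN (by omega)) s hb
    refine ⟨r, a - r * (z ^ (e - s) * l), hN' _ ?_, by ring⟩
    convert hn using 1
    have : z ^ e = z ^ s * z ^ (e - s) := by rw [← pow_add, Nat.add_sub_cancel' hs]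
    rw [this] at h
    linear_combination h
  have hNJ : ∀ n ∈ N, n ∈ J := fun n hn => (hJ n).mpr ⟨0, n, hn, by ring⟩
  have hlift : ∀ s b, z ^ s * b ∈ JB → z ^ (e + s) * b ∈ J := by
    intro s b hb
    obtain ⟨r, n, hn, h⟩ := (hJB _).mp hb
    exact (hJ _).mpr ⟨r, z ^ e * n, N.mul_mem_left _ hn, by rw [pow_add, mul_assoc, h]; ring⟩
  intro f j m hjm a ha hza
  rcases lt_trichotomy (f + 1) e with hf | hf | hf
  · obtain ⟨r, n, hn, h⟩ := hreg (f + 1) a hf.le hza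
    refine ⟨0, r * (z ^ (e - (f + 1) - 1) * l), n, by simp, J.mul_mem_left _ (hNJ n hn), ?_⟩
    obtain ⟨q, hq⟩ := Nat.exists_eq_add_of_lt hf
    rw [show e - (f + 1) = q + 1 by omega] at h
    rw [show e - (f + 1) - 1 = q by omega, h]
    ring
  · obtain ⟨r, n, hn, h⟩ := hreg (f + 1) a hf.le hza
    rw [hf, Nat.sub_self, pow_zero, one_mul] at h
    obtain ⟨b, hb, g, n', hn', h'⟩ := HU (by omega) j m (by omega) a ha ((hJB a).mpr ⟨r, n, hn, h⟩)
    refine ⟨b, g, n', ?_, J.mul_mem_left _ (hNJ n' hn'), h'⟩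
    have := hlift 0 b (by simpa using hb)
    rwa [hf]
  · obtain ⟨f', rfl⟩ := Nat.exists_eq_add_of_le (show e ≤ f by omega)
    have hza' : z ^ (f' + 1) * a ∈ JB := by
      rw [add_assoc, pow_add, mul_assoc] at hza
      obtain ⟨r, n, hn, h⟩ := hreg e _ le_rfl hza
      exact (hJB _).mpr ⟨r, n, hn, by rw [h, Nat.sub_self, pow_zero, one_mul]⟩
    obtain ⟨b, g, h, hb, hh, e'⟩ := HB f' j m (by omega) a ha hza'
    exact ⟨b, g, h, by rw [add_assoc]; exact hlift _ b hb, hlift _ h hh, e'⟩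

end CentralSimpleOperations

/-! ### The ideals occurring in the induction -/

section Triangular

variable {K : Type*} [Field K] {n : ℕ}

/-- The generators `u₀, …, u_{k-1}, x_k ^ d_k * l_k, …, x_{n-1} ^ d_{n-1} * l_{n-1}`. In the
induction the `u i` are linear forms. -/
noncomputable def mixedGenerators (l : Fin n → MvPolynomial (Fin n) K) (k : ℕ)
    (u : Fin n → MvPolynomial (Fin n) K) (d : Fin n → ℕ) (i : Fin n) : MvPolynomial (Fin n) K :=
  if (i : ℕ) < k then u i else X i ^ d i * l i

/-- The degree of the socle of the complete intersection with generators
`mixedGenerators l k u d`. -/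
def socleDegree (k : ℕ) (d : Fin n → ℕ) : ℕ :=
  ∑ i ∈ Finset.univ.filter (fun i : Fin n => k ≤ i), d i

lemma filter_le_eq_insert (k : Fin n) : Finset.univ.filter (fun i : Fin n => (k : ℕ) ≤ i) =
    insert k (Finset.univ.filter (fun i : Fin n => (k : ℕ) + 1 ≤ i)) := by
  ext i
  simp only [Finset.mem_filter, Finset.mem_univ, true_and, Finset.mem_insert, Fin.ext_iff]
  omega

lemma socleDegree_eq_add (k : Fin n) (d : Fin n → ℕ) :
    socleDegree k d = socleDegree (k + 1) d + d k := by
  rw [socleDegree, filter_le_eq_insert, Finset.sum_insert (by simp), add_comm, socleDegree]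

lemma socleDegree_self (d : Fin n → ℕ) : socleDegree n d = 0 := by
  refine Finset.sum_eq_zero fun i hi => ?_
  have := (Finset.mem_filter.mp hi).2
  omega

lemma socleDegree_update_of_lt {k : ℕ} {i : Fin n} (hi : (i : ℕ) < k) (d : Fin n → ℕ) (e : ℕ) :
    socleDegree k (Function.update d i e) = socleDegree k d := by
  refine Finset.sum_congr rfl fun j hj => ?_
  have := (Finset.mem_filter.mp hj).2
  rw [Function.update_of_ne]
  rintro rfl
  omega

variable {l : Fin n → MvPolynomial (Fin n) K} {u : Fin n → MvPolynomial (Fin n) K} {d : Fin n → ℕ}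

lemma mixedGenerators_self (k : Fin n) : mixedGenerators l k u d k = X k ^ d k * l k := by
  simp [mixedGenerators]

lemma mixedGenerators_succ_update (k : Fin n) (w : MvPolynomial (Fin n) K) :
    mixedGenerators l (k + 1) (Function.update u k w) d =
      Function.update (mixedGenerators l k u d) k w := by
  funext i
  by_cases h : i = k
  · subst h; simp [mixedGenerators]
  · have h' : (i : ℕ) ≠ k := fun e => h (Fin.ext e)
    rw [Function.update_of_ne h, mixedGenerators, mixedGenerators, Function.update_of_ne h]
    by_cases h2 : (i : ℕ) < k
    · rw [if_pos h2, if_pos (by omega)]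
    · rw [if_neg h2, if_neg (by omega)]

lemma isLinearProduct_mixedGenerators (hl : ∀ i, (l i).IsHomogeneous 1)
    (hu : ∀ i, (u i).IsHomogeneous 1) (k : ℕ) (i : Fin n) :
    IsLinearProduct (mixedGenerators l k u d i) := by
  rw [mixedGenerators]
  split_ifs
  · exact isLinearProduct_of_isHomogeneous (hu i)
  · exact isLinearProduct_pow_mul (isHomogeneous_X K i) (hl i) _

lemma exists_isHomogeneous_mixedGenerators (hl : ∀ i, (l i).IsHomogeneous 1)
    (hu : ∀ i, (u i).IsHomogeneous 1) (k : ℕ) (i : Fin n) :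
    ∃ e, (mixedGenerators l k u d i).IsHomogeneous e := by
  rw [mixedGenerators]
  split_ifs
  · exact ⟨1, hu i⟩
  · exact ⟨_, ((isHomogeneous_X K i).pow (d i)).mul (hl i)⟩

/-- The ideal generated by `mixedGenerators l k u d`. -/
noncomputable def mixedIdeal (l : Fin n → MvPolynomial (Fin n) K) (k : ℕ)
    (u : Fin n → MvPolynomial (Fin n) K) (d : Fin n → ℕ) : Ideal (MvPolynomial (Fin n) K) :=
  Ideal.span (Set.range (mixedGenerators l k u d))

lemma isHomogeneousIdeal_mixedIdeal (hl : ∀ i, (l i).IsHomogeneous 1)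
    (hu : ∀ i, (u i).IsHomogeneous 1) (k : ℕ) : IsHomogeneousIdeal (mixedIdeal l k u d) := by
  choose e he using exists_isHomogeneous_mixedGenerators (d := d) hl hu k
  exact isHomogeneousIdeal_span _ e he

/-- The ideal generated by all `mixedGenerators l k u d i` with `i ≠ k`. -/
noncomputable def complementIdeal (l : Fin n → MvPolynomial (Fin n) K) (k : Fin n)
    (u : Fin n → MvPolynomial (Fin n) K) (d : Fin n → ℕ) : Ideal (MvPolynomial (Fin n) K) :=
  Ideal.span (mixedGenerators l k u d '' {k}ᶜ)

lemma isHomogeneousIdeal_complementIdeal (hl : ∀ i, (l i).IsHomogeneous 1)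
    (hu : ∀ i, (u i).IsHomogeneous 1) (k : Fin n) :
    IsHomogeneousIdeal (complementIdeal l k u d) := by
  choose e he using exists_isHomogeneous_mixedGenerators (d := d) hl hu k
  rw [complementIdeal, Set.image_eq_range]
  exact isHomogeneousIdeal_span _ (fun i => e i) fun i => he i

lemma mem_mixedIdeal {k : Fin n} {x : MvPolynomial (Fin n) K} : x ∈ mixedIdeal l k u d ↔
    ∃ r, ∃ y ∈ complementIdeal l k u d, x = r * (X k ^ d k * l k) + y := by
  have := mem_span_range_update (f := mixedGenerators l k u d) (k := k)
    (w := mixedGenerators l k u d k) (x := x)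
  rwa [Function.update_eq_self, mixedGenerators_self] at this

lemma mem_mixedIdeal_succ {k : Fin n} {w x : MvPolynomial (Fin n) K} :
    x ∈ mixedIdeal l (k + 1) (Function.update u k w) d ↔
      ∃ r, ∃ y ∈ complementIdeal l k u d, x = r * w + y := by
  rw [mixedIdeal, mixedGenerators_succ_update]
  exact mem_span_range_update

/-- In the `k`-th step of the induction, `x_k` and the linear forms `u_i`, `i < k`, which have been
killed so far, span all of `x₀, …, x_k`. (For `k = n` there is no `x_k`.) -/
def SpansVariables (k : ℕ) (u : Fin n → MvPolynomial (Fin n) K) : Prop :=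
  ∀ i : Fin n, (i : ℕ) < k → (X i : MvPolynomial (Fin n) K) ∈
    Submodule.span K (u '' {j | (j : ℕ) < k} ∪ X '' {j | (j : ℕ) = k})

/-- The linear forms `l_k` of the theorem: `l_k` is a combination of `x₀, …, x_{k+1}`. -/
def IsTriangular (l : Fin n → MvPolynomial (Fin n) K) : Prop :=
  ∀ i : Fin n, l i ∈ Submodule.span K (X '' {j : Fin n | (j : ℕ) ≤ i + 1})

lemma span_le_homogeneousSubmodule_one (hu : ∀ i, (u i).IsHomogeneous 1) (S : Set (Fin n)) :
    Submodule.span K (u '' S) ≤ homogeneousSubmodule (Fin n) K 1 := by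
  rw [Submodule.span_le]
  rintro _ ⟨i, _, rfl⟩
  exact hu i

lemma IsTriangular.isHomogeneous (htri : IsTriangular l) (i : Fin n) : (l i).IsHomogeneous 1 :=
  span_le_homogeneousSubmodule_one (fun i => isHomogeneous_X K i) _ (htri i)

lemma eval_eq_zero_of_mem_span {S : Set (Fin n)} {v : Fin n → K} (hv : ∀ i ∈ S, eval v (u i) = 0)
    {p : MvPolynomial (Fin n) K} (hp : p ∈ Submodule.span K (u '' S)) : eval v p = 0 := by
  induction hp using Submodule.span_induction with
  | mem x hx => obtain ⟨i, hi, rfl⟩ := hx; exact hv i hi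
  | zero => simp
  | add x y _ _ hx hy => rw [map_add, hx, hy, add_zero]
  | smul r x _ hx => rw [smul_eval, hx, mul_zero]

/-- Modulo the linear forms killed so far, `l_k` is a combination of `x_k` and `x_{k+1}` in which
`x_k` occurs, as otherwise all generators vanish on a common line. -/
lemma IsTriangular.exists_eq (htri : IsTriangular l) (k : Fin n)
    (hu : ∀ i, (u i).IsHomogeneous 1) (hd : ∀ i : Fin n, (k : ℕ) < i → 0 < d i)
    (hspan : SpansVariables k u) (hZ : OnlyTrivialZero (mixedGenerators l k u d)) :
    ∃ m ∈ Submodule.span K (u '' {j | (j : ℕ) < k}), ∃ α : K, α ≠ 0 ∧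
      (l k = m + C α * X k ∨ ∃ h : (k : ℕ) + 1 < n, ∃ β : K, β ≠ 0 ∧
        l k = m + C α * X k + C β * X ⟨k + 1, h⟩) := by
  have hle : Submodule.span K (X '' {j : Fin n | (j : ℕ) ≤ k + 1}) ≤
      Submodule.span K (u '' {j | (j : ℕ) < k}) ⊔ Submodule.span K {X k} ⊔
        Submodule.span K (X '' {j : Fin n | (j : ℕ) = k + 1}) := by
    rw [Submodule.span_le]
    rintro _ ⟨i, hi, rfl⟩
    have hi : (i : ℕ) ≤ k + 1 := hi
    have hk : (X '' {j : Fin n | (j : ℕ) = k} : Set (MvPolynomial (Fin n) K)) = {X k} := by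
      rw [← Set.image_singleton]
      congr 1
      ext j
      simp [Fin.ext_iff]
    rcases lt_trichotomy (i : ℕ) k with h | h | h
    · have := hspan i h
      rw [Submodule.span_union, hk] at this
      exact Submodule.mem_sup_left this
    · refine Submodule.mem_sup_left (Submodule.mem_sup_right ?_)
      rw [Fin.ext h]
      exact Submodule.mem_span_singleton_self _
    · have h' : (i : ℕ) = k + 1 := by omega
      exact Submodule.mem_sup_right (Submodule.subset_span ⟨i, h', rfl⟩)
  obtain ⟨p, hp, q, hq, hpq⟩ := Submodule.mem_sup.mp (hle (htri k))
  obtain ⟨m, hm, x, hx, rfl⟩ := Submodule.mem_sup.mp hp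
  obtain ⟨α, rfl⟩ := Submodule.mem_span_singleton.mp hx
  -- a point killed by the `u i`, `i < k`, and the variables after `x_k`
  obtain ⟨v, hv0, hv⟩ := exists_ne_zero_forall_eval_eq_zero (k := k)
    (w := fun i : Fin n => if (i : ℕ) < k then u i else if i = k then 0 else X i) (by
      intro i
      split_ifs
      · exact hu i
      · exact isHomogeneous_zero _ _ _
      · exact isHomogeneous_X K i) (by simp)
  have hvu : ∀ i : Fin n, (i : ℕ) < k → eval v (u i) = 0 := by
    intro i hi
    have := hv i
    rwa [if_pos hi] at this
  have hvX : ∀ i : Fin n, (k : ℕ) < i → eval v (X i) = 0 := by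
    intro i hi
    have := hv i
    rwa [if_neg (by omega), if_neg (by rintro rfl; omega)] at this
  have hα : α ≠ 0 := by
    rintro rfl
    have hlk : eval v (l k) = 0 := by
      rw [← hpq, zero_smul, add_zero, map_add, eval_eq_zero_of_mem_span hvu hm,
        eval_eq_zero_of_mem_span (u := X) (fun i hi => hvX i ?_) hq, add_zero]
      have : (i : ℕ) = k + 1 := hi
      omega
    refine hv0 (hZ v fun i => ?_)
    rw [mixedGenerators]
    rcases lt_trichotomy (i : ℕ) k with h | h | h
    · rw [if_pos h, hvu i h]
    · obtain rfl : i = k := Fin.ext h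
      rw [if_neg (by omega), map_mul, hlk, mul_zero]
    · rw [if_neg (by omega), map_mul, map_pow, hvX i h, zero_pow (hd i h).ne', zero_mul]
  refine ⟨m, hm, α, hα, ?_⟩
  rw [smul_eq_C_mul] at hpq
  by_cases h : (k : ℕ) + 1 < n
  · have hk : (X '' {j : Fin n | (j : ℕ) = k + 1} : Set (MvPolynomial (Fin n) K)) =
        {X ⟨k + 1, h⟩} := by
      rw [← Set.image_singleton]
      congr 1
      ext j
      simp [Fin.ext_iff]
    rw [hk, Submodule.mem_span_singleton] at hq
    obtain ⟨β, rfl⟩ := hq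
    rw [smul_eq_C_mul] at hpq
    by_cases hβ : β = 0
    · left; rw [← hpq, hβ, C_0, zero_mul, add_zero]
    · right; exact ⟨h, β, hβ, hpq.symm⟩
  · have hk : (X '' {j : Fin n | (j : ℕ) = k + 1} : Set (MvPolynomial (Fin n) K)) = ∅ := by
      rw [Set.image_eq_empty]
      refine Set.eq_empty_of_forall_notMem fun j (hj : (j : ℕ) = k + 1) => ?_
      omega
    rw [hk, Submodule.span_empty, Submodule.mem_bot] at hq
    left; rw [← hpq, hq, add_zero]

end Triangular

/-! ### The induction -/

section Induction

variable {K : Type*} [Field K] {n : ℕ} {l : Fin n → MvPolynomial (Fin n) K}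
  {u : Fin n → MvPolynomial (Fin n) K} {d : Fin n → ℕ}

lemma span_le_complementIdeal (k : Fin n) :
    Submodule.span K (u '' {j | (j : ℕ) < k}) ≤ (complementIdeal l k u d).restrictScalars K := by
  rw [Submodule.span_le]
  rintro _ ⟨j, hj, rfl⟩
  have hj : (j : ℕ) < k := hj
  refine Ideal.subset_span ⟨j, ?_, by rw [mixedGenerators, if_pos hj]⟩
  rintro rfl
  exact lt_irrefl _ hj

lemma SpansVariables.X_mem_mixedIdeal (h : SpansVariables n u) (i : Fin n) :
    X i ∈ mixedIdeal l n u d := by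
  have hle : Submodule.span K (u '' {j | (j : ℕ) < n} ∪ X '' {j : Fin n | (j : ℕ) = n}) ≤
      (mixedIdeal l n u d).restrictScalars K := by
    rw [Submodule.span_le]
    rintro _ (⟨j, hj, rfl⟩ | ⟨j, hj, rfl⟩)
    · exact Ideal.subset_span ⟨j, by rw [mixedGenerators, if_pos j.2]⟩
    · exact absurd hj j.2.ne
  exact hle (h i i.2)

lemma mem_of_forall_X_mem {J : Ideal (MvPolynomial (Fin n) K)} (h : ∀ i, X i ∈ J) {j : ℕ}
    {a : MvPolynomial (Fin n) K} (ha : a.IsHomogeneous (j + 1)) : a ∈ J := by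
  have ha' : a ∈ homogeneousSubmodule (Fin n) K 1 * homogeneousSubmodule (Fin n) K j := by
    rw [← homogeneousSubmodule_one_pow (R := K) j, ← pow_succ', homogeneousSubmodule_one_pow]
    exact ha
  refine Submodule.mul_induction_on ha' (fun p hp q _ => ?_) fun p q hp hq => add_mem hp hq
  obtain ⟨r, rfl⟩ := exists_coeff_of_isHomogeneous_one hp
  exact J.mul_mem_right _ (sum_mem fun i _ => J.mul_mem_left _ (h i))

lemma SpansVariables.succ {k : Fin n} (h : SpansVariables k u) {w : MvPolynomial (Fin n) K}
    (hw : X k ∈ Submodule.span K (Function.update u k w '' {j | (j : ℕ) < k + 1} ∪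
      X '' {j | (j : ℕ) = k + 1})) : SpansVariables (k + 1) (Function.update u k w) := by
  intro i hi
  rcases (Nat.lt_succ_iff_lt_or_eq.mp hi) with hi | hi
  · refine (Submodule.span_le.mpr ?_) (h i hi)
    rintro _ (⟨j, hj, rfl⟩ | ⟨j, hj, rfl⟩)
    · have hj : (j : ℕ) < k := hj
      refine Submodule.subset_span (Or.inl ⟨j, (show (j : ℕ) < k + 1 by omega), ?_⟩)
      rw [Function.update_of_ne]
      rintro rfl
      exact lt_irrefl _ hj
    · obtain rfl : j = k := Fin.ext hj
      exact hw
  · obtain rfl : i = k := Fin.ext hi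
    exact hw

lemma OnlyTrivialZero.update {f : Fin n → MvPolynomial (Fin n) K} (h : OnlyTrivialZero f)
    {k : Fin n} {w : MvPolynomial (Fin n) K}
    (hw : ∀ v, (∀ i ≠ k, eval v (f i) = 0) → eval v w = 0 → eval v (f k) = 0) :
    OnlyTrivialZero (Function.update f k w) := by
  intro v hv
  have h1 : ∀ i ≠ k, eval v (f i) = 0 := by
    intro i hi
    have := hv i
    rwa [Function.update_of_ne hi] at this
  refine h v fun i => ?_
  by_cases hi : i = k
  · subst hi
    exact hw v h1 (by simpa using hv i)
  · exact h1 i hi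

lemma pow_add_mem_mixedIdeal {k : Fin n} {N : ℕ}
    (h : ∃ r, ∃ y ∈ complementIdeal l k u d, X k ^ N = r * l k + y) :
    X k ^ (d k + N) ∈ mixedIdeal l k u d := by
  obtain ⟨r, y, hy, h⟩ := h
  exact mem_mixedIdeal.mpr ⟨r, X k ^ d k * y, Ideal.mul_mem_left _ _ hy, by
    rw [pow_add, h]; ring⟩

/-- The main induction: for generic `y`, the ideals `mixedIdeal l k u d` satisfy the Lefschetz
condition, also for all central simple modules of `x_k`. -/
theorem genericLinear_lefschetz_mixedIdeal [CharZero K] (htri : IsTriangular l) (r : ℕ) :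
    ∀ (k : ℕ) (u : Fin n → MvPolynomial (Fin n) K) (d : Fin n → ℕ), k + r = n →
      (∀ i, (u i).IsHomogeneous 1) → (∀ i : Fin n, k < i → 0 < d i) → SpansVariables k u →
      OnlyTrivialZero (mixedGenerators l k u d) →
      GenericLinear (LefschetzSurjective (mixedIdeal l k u d) (socleDegree k d)) ∧
      ∀ hk : k < n,
        GenericLinear (CentralSimpleLefschetz (mixedIdeal l k u d) (X ⟨k, hk⟩) (socleDegree k d)) ∧
        ∃ N, (X ⟨k, hk⟩ : MvPolynomial (Fin n) K) ^ N ∈ mixedIdeal l k u d := by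
  induction r with
  | zero =>
    intro k u d hk hu hd hspan hZ
    obtain rfl : k = n := by omega
    refine ⟨LefschetzSurjective.genericLinear
      (isHomogeneousIdeal_mixedIdeal htri.isHomogeneous hu _) (isHomogeneous_zero _ _ 1) ?_,
      fun h => absurd h (lt_irrefl _)⟩
    intro j m hjm a ha
    rw [socleDegree_self] at hjm
    rcases j with _ | j
    · obtain rfl : m = 0 := by omega
      exact ⟨a, by simp⟩
    · exact ⟨0, by simpa using mem_of_forall_X_mem hspan.X_mem_mixedIdeal ha⟩
  | succ r ih =>
    intro k₀ u d hkr hu hd hspan hZ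
    have hk₀ : k₀ < n := by omega
    obtain ⟨k, rfl⟩ : ∃ k : Fin n, (k : ℕ) = k₀ := ⟨⟨k₀, hk₀⟩, rfl⟩
    have hl := htri.isHomogeneous
    have hJ := isHomogeneousIdeal_mixedIdeal (d := d) hl hu k
    -- the second part implies the first
    suffices h : GenericLinear (CentralSimpleLefschetz (mixedIdeal l k u d) (X k)
        (socleDegree k d)) ∧ ∃ N, (X k : MvPolynomial (Fin n) K) ^ N ∈ mixedIdeal l k u d by
      refine ⟨?_, fun _ => h⟩
      obtain ⟨y, hy, hy'⟩ := h.1.exists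
      obtain ⟨L, hL, hL'⟩ := hy'.exists_lefschetzSurjective hJ (isHomogeneous_X K k) hy h.2
      exact hL'.genericLinear hJ hL
    have hreg : d k ≠ 0 → ∀ a, X k * a ∈ complementIdeal l k u d → a ∈ complementIdeal l k u d := by
      intro hd0 a ha
      refine mem_span_of_linear_mul_mem (isLinearProduct_mixedGenerators hl hu k)
        (isHomogeneous_X K k) (hZ.update fun v _ hv => ?_) ha
      rw [mixedGenerators_self, map_mul, map_pow, hv, zero_pow hd0, zero_mul]
    have hupd : ∀ w : MvPolynomial (Fin n) K, w.IsHomogeneous 1 →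
        ∀ i, (Function.update u k w i).IsHomogeneous 1 := by
      intro w hw i
      by_cases h : i = k
      · subst h; simpa using hw
      · rw [Function.update_of_ne h]; exact hu i
    have hZu : ∀ v : Fin n → K, (∀ i ≠ k, eval v (mixedGenerators l k u d i) = 0) →
        ∀ j : Fin n, (j : ℕ) < k → eval v (u j) = 0 := by
      intro v hv j hj
      have := hv j (by rintro rfl; exact lt_irrefl _ hj)
      rwa [mixedGenerators, if_pos hj] at this
    have hd' : ∀ i : Fin n, (k : ℕ) + 1 < i → 0 < d i := fun i hi => hd i (by omega)
    have hc : socleDegree k d = socleDegree (k + 1) d + d k := socleDegree_eq_add k d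
    obtain ⟨m, hm, α, hα, hlk | ⟨hk1, β, hβ, hlk⟩⟩ := htri.exists_eq k hu hd hspan hZ
    · -- here `l k` and `X k` agree up to a scalar modulo the `u i`, `i < k`
      have hmN : m ∈ complementIdeal l k u d := span_le_complementIdeal k hm
      have hαC : C α⁻¹ * C α = (1 : MvPolynomial (Fin n) K) := by
        rw [← C_mul, inv_mul_cancel₀ hα, C_1]
      have hspan' : SpansVariables (k + 1) (Function.update u k (X k)) :=
        hspan.succ (Submodule.subset_span (Or.inl ⟨k, Nat.lt_succ_self _, by simp⟩))
      have hZ' : OnlyTrivialZero (mixedGenerators l (k + 1) (Function.update u k (X k)) d) := by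
        rw [mixedGenerators_succ_update]
        refine hZ.update fun v hv hv' => ?_
        rw [mixedGenerators_self, map_mul, hlk, map_add, map_mul, hv',
          eval_eq_zero_of_mem_span (hZu v hv) hm, mul_zero, add_zero, mul_zero]
      have hJB : ∀ x, x ∈ mixedIdeal l (k + 1) (Function.update u k (X k)) d ↔
          ∃ r, ∃ n ∈ complementIdeal l k u d, x = r * l k + n := by
        intro x
        rw [mem_mixedIdeal_succ]
        constructor
        · rintro ⟨r, y, hy, rfl⟩
          refine ⟨r * C α⁻¹, y - r * C α⁻¹ * m, sub_mem hy (Ideal.mul_mem_left _ _ hmN), ?_⟩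
          rw [hlk]
          linear_combination (-r * X k) * hαC
        · rintro ⟨r, y, hy, rfl⟩
          refine ⟨r * C α, y + r * m, add_mem hy (Ideal.mul_mem_left _ _ hmN), ?_⟩
          rw [hlk]; ring
      have hXk : X k ∈ mixedIdeal l (k + 1) (Function.update u k (X k)) d :=
        mem_mixedIdeal_succ.mpr ⟨1, 0, zero_mem _, by ring⟩
      refine ⟨((ih (k + 1) _ d (by omega) (hupd _ (isHomogeneous_X K k)) hd' hspan' hZ').1).mono
        fun y hy hB => ?_, d k + 1, ?_⟩
      · refine CentralSimpleLefschetz.of_pow_mul (fun x => mem_mixedIdeal) hJB hreg hc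
          (CentralSimpleLefschetz.of_mem hXk hB) ?_
        intro _ j m' _ a _ haB
        obtain ⟨r, y', hy', rfl⟩ := mem_mixedIdeal_succ.mp haB
        exact ⟨0, zero_mem _, r, y', hy', by ring⟩
      · exact pow_add_mem_mixedIdeal (by simpa using (hJB _).mp hXk)
    · have hmN : m ∈ complementIdeal l k u d := span_le_complementIdeal k hm
      set k' : Fin n := ⟨k + 1, hk1⟩ with hk'
      have hk'v : (k' : ℕ) = k + 1 := rfl
      have hkk' : k' ≠ k := by
        intro h
        have := congrArg Fin.val h
        omega
      have hαC : C α⁻¹ * C α = (1 : MvPolynomial (Fin n) K) := by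
        rw [← C_mul, inv_mul_cancel₀ hα, C_1]
      have hβC : C β⁻¹ * C β = (1 : MvPolynomial (Fin n) K) := by
        rw [← C_mul, inv_mul_cancel₀ hβ, C_1]
      have hdk' : 0 < d k' := hd k' (by omega)
      -- the quotient in which `l k` is killed
      have hspanB : SpansVariables (k + 1) (Function.update u k (l k)) := by
        refine hspan.succ ?_
        have h1 : X k = α⁻¹ • (l k - m - β • X k') := by
          rw [hlk, smul_eq_C_mul, smul_eq_C_mul]
          linear_combination (-X k) * hαC
        rw [h1]
        refine Submodule.smul_mem _ _ (sub_mem (sub_mem ?_ ?_) (Submodule.smul_mem _ _ ?_))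
        · exact Submodule.subset_span (Or.inl ⟨k, Nat.lt_succ_self _, by simp⟩)
        · refine Submodule.span_mono (Set.subset_union_of_subset_left ?_ _) hm
          rintro _ ⟨j, hj, rfl⟩
          have hj : (j : ℕ) < k := hj
          refine ⟨j, (show (j : ℕ) < k + 1 by omega), ?_⟩
          rw [Function.update_of_ne]
          rintro rfl
          exact lt_irrefl _ hj
        · exact Submodule.subset_span (Or.inr ⟨k', hk'v, rfl⟩)
      have hZB : OnlyTrivialZero (mixedGenerators l (k + 1) (Function.update u k (l k)) d) := by
        rw [mixedGenerators_succ_update]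
        refine hZ.update fun v hv hv' => ?_
        rw [mixedGenerators_self, map_mul, hv', mul_zero]
      obtain ⟨hB, NB, hNB⟩ :=
        (ih (k + 1) _ d (by omega) (hupd _ (hl k)) hd' hspanB hZB).2 hk1
      have hγ : -α / β ≠ 0 := div_ne_zero (neg_ne_zero.mpr hα) hβ
      have hX : X k' - C (-α / β) * X k ∈ mixedIdeal l (k + 1) (Function.update u k (l k)) d := by
        refine mem_mixedIdeal_succ.mpr ⟨C β⁻¹, -(C β⁻¹ * m),
          neg_mem (Ideal.mul_mem_left _ _ hmN), ?_⟩
        rw [hlk, div_eq_mul_inv, C_mul, C_neg]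
        linear_combination (-X k') * hβC
      have hX' : X k - C (-α / β)⁻¹ * X k' ∈
          mixedIdeal l (k + 1) (Function.update u k (l k)) d := by
        have h1 : C (-α / β)⁻¹ * C (-α / β) = (1 : MvPolynomial (Fin n) K) := by
          rw [← C_mul, inv_mul_cancel₀ hγ, C_1]
        convert neg_mem (Ideal.mul_mem_left _ (C (-α / β)⁻¹) hX) using 1
        linear_combination (-X k) * h1
      -- the quotient isomorphic to the ideal generated by `l k` modulo `X k`
      set dU := Function.update d k' (d k' - 1) with hdU
      have hspanU : SpansVariables (k + 1) (Function.update u k (X k)) :=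
        hspan.succ (Submodule.subset_span (Or.inl ⟨k, Nat.lt_succ_self _, by simp⟩))
      have hgenU : ∀ i ≠ k, i ≠ k' → mixedGenerators l (k + 1) (Function.update u k (X k)) dU i =
          mixedGenerators l k u d i := by
        intro i hi hi'
        have h1 : mixedGenerators l (k + 1) (Function.update u k (X k)) dU i =
            mixedGenerators l (k + 1) (Function.update u k (X k)) d i := by
          rw [mixedGenerators, mixedGenerators, hdU, Function.update_of_ne hi']
        rw [h1, mixedGenerators_succ_update, Function.update_of_ne hi]
      have hgenUk : mixedGenerators l (k + 1) (Function.update u k (X k)) dU k = X k := by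
        simp [mixedGenerators]
      have hgenUk' : mixedGenerators l (k + 1) (Function.update u k (X k)) dU k' =
          X k' ^ (d k' - 1) * l k' := by
        rw [mixedGenerators, if_neg (by omega), hdU, Function.update_self]
      have hgenk' : X k' * (X k' ^ (d k' - 1) * l k') = mixedGenerators l k u d k' := by
        rw [mixedGenerators, if_neg (by omega), ← mul_assoc, ← pow_succ',
          Nat.sub_add_cancel hdk']
      have hcU : socleDegree (k + 1) dU + 1 = socleDegree (k + 1) d := by
        have h1 : socleDegree (k + 1) d = socleDegree (k' + 1) d + d k' := socleDegree_eq_add k' d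
        have h2 : socleDegree (k + 1) dU = socleDegree (k' + 1) dU + dU k' :=
          socleDegree_eq_add k' dU
        have h3 : dU k' = d k' - 1 := Function.update_self ..
        have h4 : socleDegree (k' + 1) dU = socleDegree (k' + 1) d :=
          socleDegree_update_of_lt (Nat.lt_succ_self _) d _
        omega
      have hU : GenericLinear fun y => d k ≠ 0 → LefschetzSurjective
          (mixedIdeal l (k + 1) (Function.update u k (X k)) dU) (socleDegree (k + 1) dU) y := by
        by_cases hd0 : d k = 0
        · exact hB.mono fun _ _ _ h => absurd hd0 h
        · refine GenericLinear.mono (ih (k + 1) _ dU (by omega) (hupd _ (isHomogeneous_X K k))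
            ?_ hspanU ?_).1 fun _ _ h _ => h
          · intro i hi
            rw [hdU, Function.update_of_ne]
            · exact hd' i hi
            · rintro rfl
              omega
          · intro v hv
            refine hZ v fun i => ?_
            by_cases hik : i = k
            · subst hik
              have := hv i
              rw [hgenUk] at this
              rw [mixedGenerators_self, map_mul, map_pow, this, zero_pow hd0, zero_mul]
            · by_cases hik' : i = k'
              · rw [hik', ← hgenk', map_mul, ← hgenUk', hv, mul_zero]
              · rw [← hgenU i hik hik']
                exact hv i
      have hlU : ∀ x ∈ mixedIdeal l (k + 1) (Function.update u k (X k)) dU,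
          ∃ g, ∃ y ∈ complementIdeal l k u d, l k * x = X k * g + y := by
        intro x hx
        induction hx using Submodule.span_induction with
        | mem x hx =>
          obtain ⟨i, rfl⟩ := hx
          by_cases hik : i = k
          · subst hik
            exact ⟨l i, 0, zero_mem _, by rw [hgenUk]; ring⟩
          · by_cases hik' : i = k'
            · rw [hik', hgenUk']
              have h1 : mixedGenerators l k u d k' ∈ complementIdeal l k u d :=
                Ideal.subset_span ⟨k', hkk', rfl⟩
              refine ⟨C α * (X k' ^ (d k' - 1) * l k'), m * (X k' ^ (d k' - 1) * l k') +
                C β * mixedGenerators l k u d k', add_mem (Ideal.mul_mem_right _ _ hmN)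
                (Ideal.mul_mem_left _ _ h1), ?_⟩
              rw [← hgenk', hlk]; ring
            · rw [hgenU i hik hik']
              exact ⟨0, _, Ideal.mul_mem_left _ _ (Ideal.subset_span ⟨i, hik, rfl⟩), by ring⟩
        | zero => exact ⟨0, 0, zero_mem _, by ring⟩
        | add x y _ _ hx hy =>
          obtain ⟨g, z, hz, h⟩ := hx
          obtain ⟨g', z', hz', h'⟩ := hy
          exact ⟨g + g', z + z', add_mem hz hz', by linear_combination h + h'⟩
        | smul s x _ hx =>
          obtain ⟨g, z, hz, h⟩ := hx
          exact ⟨s * g, s * z, Ideal.mul_mem_left _ _ hz, by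
            rw [smul_eq_mul]; linear_combination s * h⟩
      refine ⟨(hB.and hU).mono fun y hy ⟨hyB, hyU⟩ => ?_, d k + NB, ?_⟩
      · refine CentralSimpleLefschetz.of_pow_mul (fun x => mem_mixedIdeal)
          (fun x => mem_mixedIdeal_succ) hreg hc (hyB.congr hγ hX) ?_
        intro hd0 j m' hjm a ha haB
        obtain ⟨r, y', hy', h⟩ := mem_mixedIdeal_succ.mp haB
        rcases exists_homogeneous_factor (isHomogeneousIdeal_complementIdeal hl hu k) ha (hl k)
          (b := r) (by rw [h]; convert hy' using 1; ring) with h | ⟨hj, r', hr', h⟩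
        · exact ⟨0, zero_mem _, 0, a, h.1, by ring⟩
        · obtain ⟨b, hb⟩ := hyU hd0 (j - 1) m' (by omega) r' hr'
          obtain ⟨g, z, hz, h'⟩ := hlU _ hb
          refine ⟨l k * b, mem_mixedIdeal_succ.mpr ⟨b, 0, zero_mem _, by ring⟩, g,
            z + (a - l k * r'), add_mem hz h, ?_⟩
          linear_combination h'
      · have h1 : X k ^ NB - (C (-α / β)⁻¹ * X k') ^ NB ∈
            mixedIdeal l (k + 1) (Function.update u k (l k)) d :=
          Ideal.mem_of_dvd _ (sub_dvd_pow_sub_pow _ _ NB) hX'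
        have h2 : X k ^ NB ∈ mixedIdeal l (k + 1) (Function.update u k (l k)) d := by
          have := add_mem h1 (Ideal.mul_mem_left _ (C (-α / β)⁻¹ ^ NB) hNB)
          rwa [mul_pow, sub_add_cancel] at this
        exact pow_add_mem_mixedIdeal (mem_mixedIdeal_succ.mp h2)

end Induction

/-! ### The socle -/

section Socle

variable {K : Type*} [Field K] {n : ℕ} {l : Fin n → MvPolynomial (Fin n) K} {d : Fin n → ℕ}

/-- Modulo `(x₀, …, x_{k-1}, x_k ^ d_k * l_k, …)`, the elements killed by the variables are the
multiples of `∏_{i ≥ k} x_i ^ (d_i - 1) * l_i`. -/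
lemma exists_sub_mul_prod_mem_mixedIdeal (hl : ∀ i, (l i).IsHomogeneous 1) (hd : ∀ i, 0 < d i)
    (hZ : OnlyTrivialZero (mixedGenerators l 0 X d)) (r : ℕ) :
    ∀ k, k + r = n → ∀ b, (∀ i : Fin n, k ≤ i → X i * b ∈ mixedIdeal l k X d) →
      ∃ s, b - s * ∏ i ∈ Finset.univ.filter (fun i : Fin n => k ≤ i), (X i ^ (d i - 1) * l i) ∈
        mixedIdeal l k X d := by
  induction r with
  | zero =>
    intro k hk b _
    refine ⟨b, ?_⟩
    rw [Finset.prod_eq_one, mul_one, sub_self]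
    · exact zero_mem _
    · intro i hi
      have := (Finset.mem_filter.mp hi).2
      omega
  | succ r ih =>
    intro k₀ hkr b hb
    have hk₀ : k₀ < n := by omega
    obtain ⟨k, rfl⟩ : ∃ k : Fin n, (k : ℕ) = k₀ := ⟨⟨k₀, hk₀⟩, rfl⟩
    have hX : ∀ i : Fin n, (X i : MvPolynomial (Fin n) K).IsHomogeneous 1 := isHomogeneous_X K
    have hZk : OnlyTrivialZero (mixedGenerators l k X d) := by
      intro v hv
      refine hZ v fun i => ?_
      have := hv i
      rw [mixedGenerators] at this ⊢
      rw [if_neg (by omega)]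
      split_ifs at this
      · rw [map_mul, map_pow, this, zero_pow (hd i).ne', zero_mul]
      · exact this
    have hXreg : ∀ a, X k * a ∈ complementIdeal l k X d → a ∈ complementIdeal l k X d := by
      intro a ha
      refine mem_span_of_linear_mul_mem (isLinearProduct_mixedGenerators hl hX k) (hX k)
        (hZk.update fun v _ hv => ?_) ha
      rw [mixedGenerators_self, map_mul, map_pow, hv, zero_pow (hd k).ne', zero_mul]
    have hlreg : ∀ a, l k * a ∈ complementIdeal l k X d → a ∈ complementIdeal l k X d := by
      intro a ha
      refine mem_span_of_linear_mul_mem (isLinearProduct_mixedGenerators hl hX k) (hl k)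
        (hZk.update fun v _ hv => ?_) ha
      rw [mixedGenerators_self, map_mul, hv, mul_zero]
    have hpow : (X k : MvPolynomial (Fin n) K) ^ d k = X k * X k ^ (d k - 1) := by
      rw [← pow_succ', Nat.sub_add_cancel (hd k)]
    have hsucc : ∀ x, x ∈ mixedIdeal l (k + 1) X d ↔
        ∃ r, ∃ y ∈ complementIdeal l k X d, x = r * X k + y := by
      intro x
      have := mem_mixedIdeal_succ (l := l) (u := X) (d := d) (k := k) (w := X k) (x := x)
      rwa [Function.update_eq_self] at this
    -- `b` is a multiple of `x_k ^ (d_k - 1) * l_k` as it is killed by `x_k`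
    obtain ⟨t, y, hy, e⟩ := mem_mixedIdeal.mp (hb k le_rfl)
    have hb' : b - t * (X k ^ (d k - 1) * l k) ∈ complementIdeal l k X d := by
      refine hXreg _ ?_
      convert hy using 1
      rw [hpow] at e
      linear_combination e
    obtain ⟨s, hs⟩ := ih (k + 1) (by omega) t (by
      intro i hi
      obtain ⟨t', y', hy', e'⟩ := mem_mixedIdeal.mp (hb i (by omega))
      refine (hsucc _).mpr ⟨t', X i * t - t' * X k, ?_, by ring⟩
      refine hlreg _ (Ideal.mem_of_pow_mul_mem hXreg (d k - 1) ?_)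
      convert sub_mem hy' (Ideal.mul_mem_left _ (X i) hb') using 1
      rw [hpow] at e'
      linear_combination e')
    obtain ⟨q, y', hy', e'⟩ := (hsucc _).mp hs
    refine ⟨s, mem_mixedIdeal.mpr ⟨q, y' * (X k ^ (d k - 1) * l k) +
      (b - t * (X k ^ (d k - 1) * l k)), add_mem (Ideal.mul_mem_right _ _ hy') hb', ?_⟩⟩
    rw [filter_le_eq_insert, Finset.prod_insert (by simp), hpow]
    linear_combination (X k ^ (d k - 1) * l k) * e'

/-- The socle of `R / I` is concentrated in one degree. Hence a form of smaller degree which is not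
in `I` has a multiple of that degree which is not in `I`. -/
lemma exists_mul_notMem_mixedIdeal (hl : ∀ i, (l i).IsHomogeneous 1) (hd : ∀ i, 0 < d i)
    (hZ : OnlyTrivialZero (mixedGenerators l 0 X d)) (q : ℕ) :
    ∀ (i : ℕ) (a : MvPolynomial (Fin n) K), a.IsHomogeneous i → i + q = socleDegree 0 d →
      a ∉ mixedIdeal l 0 X d → ∃ b : MvPolynomial (Fin n) K, b.IsHomogeneous q ∧
        a * b ∉ mixedIdeal l 0 X d := by
  have hX : ∀ i : Fin n, (X i : MvPolynomial (Fin n) K).IsHomogeneous 1 := isHomogeneous_X K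
  induction q with
  | zero => exact fun i a _ _ ha => ⟨1, isHomogeneous_one _ _, by rwa [mul_one]⟩
  | succ q ih =>
    intro i a hai hiq ha
    obtain ⟨j, hj⟩ : ∃ j, X j * a ∉ mixedIdeal l 0 X d := by
      by_contra! hall
      obtain ⟨s, hs⟩ := exists_sub_mul_prod_mem_mixedIdeal hl hd hZ n 0 (zero_add n) a
        fun i _ => hall i
      have hprod : (∏ i ∈ Finset.univ.filter (fun i : Fin n => 0 ≤ (i : ℕ)),
          (X i ^ (d i - 1) * l i)).IsHomogeneous (socleDegree 0 d) := by
        refine IsHomogeneous.prod _ _ _ fun i _ => ?_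
        have := ((hX i).pow (d i - 1)).mul (hl i)
        rwa [one_mul, Nat.sub_add_cancel (hd i)] at this
      rw [mul_comm] at hs
      rcases exists_homogeneous_factor (isHomogeneousIdeal_mixedIdeal hl hX 0) hai hprod hs with
        h | h
      · exact ha h.1
      · omega
    obtain ⟨b, hb, hab⟩ := ih (1 + i) (X j * a) ((hX j).mul hai) (by omega) hj
    refine ⟨X j * b, ?_, ?_⟩
    · rw [add_comm]; exact (hX j).mul hb
    · rwa [show a * (X j * b) = X j * a * b by ring]

end Socle

/-! ### The strong Lefschetz property -/

section StrongLefschetz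

variable {K : Type*} [Field K] {n : ℕ}

/-- Lefschetz surjectivity, together with a socle in the single degree `c`, yields the strong
Lefschetz property: if `L ^ (c - 2 * i)` kills `a` of degree `i`, then `a` is orthogonal
to everything of degree `c - i`. -/
lemma hasStrongLefschetzProperty_of_lefschetzSurjective {I : Ideal (MvPolynomial (Fin n) K)}
    (hI : IsHomogeneousIdeal I) {c : ℕ} {L : MvPolynomial (Fin n) K} (hL : L.IsHomogeneous 1)
    (H : LefschetzSurjective I c L)
    (hsocle : ∀ (q i : ℕ) (a : MvPolynomial (Fin n) K), a.IsHomogeneous i → i + q = c → a ∉ I →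
      ∃ b : MvPolynomial (Fin n) K, b.IsHomogeneous q ∧ a * b ∉ I) :
    HasStrongLefschetzProperty (quotientGrading I) := by
  refine ⟨⟨Ideal.Quotient.mkₐ K I L, L, hL, rfl⟩, fun e i => ?_⟩
  rcases le_or_gt c (2 * i + e) with hc | hc
  · right
    rintro ⟨_, a, ha, rfl⟩
    have ha : a.IsHomogeneous (i + e) := ha
    obtain ⟨r, hr⟩ := Nat.exists_eq_add_of_le hc
    obtain ⟨b, hb⟩ := H (i + e) (e + r) (by omega) a ha
    have hLe : (L ^ e).IsHomogeneous e := by simpa using hL.pow e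
    rcases exists_homogeneous_factor hI ha hLe (b := L ^ r * b) (by
      rwa [← mul_assoc, ← pow_add]) with h | ⟨_, b', hb', h⟩
    · refine ⟨0, Subtype.ext ?_⟩
      rw [map_zero]
      exact (Ideal.Quotient.eq_zero_iff_mem.mpr h.1).symm
    · rw [Nat.add_sub_cancel] at hb'
      refine ⟨⟨_, b', hb', rfl⟩, Subtype.ext ?_⟩
      have h1 : Ideal.Quotient.mk I a = Ideal.Quotient.mk I (L ^ e * b') :=
        Ideal.Quotient.eq.mpr h
      rw [map_mul, map_pow] at h1
      exact h1.symm
  · left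
    refine (injective_iff_map_eq_zero _).mpr ?_
    rintro ⟨_, a, ha, rfl⟩ h0
    have ha : a.IsHomogeneous i := ha
    have h1 : Ideal.Quotient.mk I L ^ e * Ideal.Quotient.mk I a = 0 := congrArg Subtype.val h0
    rw [← map_pow, ← map_mul, Ideal.Quotient.eq_zero_iff_mem] at h1
    refine Subtype.ext (Ideal.Quotient.eq_zero_iff_mem.mpr ?_)
    by_contra haI
    obtain ⟨b, hb, hab⟩ := hsocle (c - i) i a ha (by omega) haI
    obtain ⟨b', hb'⟩ := H (c - i) (c - 2 * i) (by omega) b hb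
    apply hab
    have h2 : L ^ (c - 2 * i) = L ^ (c - 2 * i - e) * L ^ e := by
      rw [← pow_add]; congr 1; omega
    rw [h2] at hb'
    convert add_mem (I.mul_mem_left a hb') (I.mul_mem_left (L ^ (c - 2 * i - e) * b') h1) using 1
    ring

/-- The theorem for ideals whose generators have only the trivial common zero. -/
theorem hasStrongLefschetzProperty_of_onlyTrivialZero [CharZero K]
    {l : Fin n → MvPolynomial (Fin n) K} (htri : IsTriangular l) {d : Fin n → ℕ}
    (hd : ∀ i, 0 < d i) (hZ : OnlyTrivialZero fun i => X i ^ d i * l i) :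
    HasStrongLefschetzProperty
      (quotientGrading (Ideal.span (Set.range fun i => X i ^ d i * l i))) := by
  have hgen : mixedGenerators l 0 X d = fun i => X i ^ d i * l i := by
    funext i
    rw [mixedGenerators, if_neg (Nat.not_lt_zero _)]
  have hX : ∀ i : Fin n, (X i : MvPolynomial (Fin n) K).IsHomogeneous 1 := isHomogeneous_X K
  rw [← hgen] at hZ ⊢
  obtain ⟨L, hL, H⟩ := (genericLinear_lefschetz_mixedIdeal htri n 0 X d (zero_add n) hX
    (fun i _ => hd i) (fun i hi => absurd hi (Nat.not_lt_zero _)) hZ).1.exists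
  exact hasStrongLefschetzProperty_of_lefschetzSurjective
    (isHomogeneousIdeal_mixedIdeal htri.isHomogeneous hX 0) hL H
    (exists_mul_notMem_mixedIdeal htri.isHomogeneous hd hZ)

lemma isTriangular_linForm {a : Matrix (Fin n) (Fin n) K}
    (ha : ∀ i j : Fin n, (i : ℕ) + 1 < (j : ℕ) → a i j = 0) : IsTriangular (linForm a) := by
  intro i
  refine sum_mem fun j _ => ?_
  rcases le_or_gt (j : ℕ) (i + 1) with h | h
  · rw [← smul_eq_C_mul]
    exact Submodule.smul_mem _ _ (Submodule.subset_span ⟨j, h, rfl⟩)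
  · rw [ha i j h, C_0, zero_mul]
    exact zero_mem _

/-- If forms of positive degree vanish at `v ≠ 0`, their quotient ring maps onto the coordinate ring
`K[t]` of the line through `v`, and is not Artinian. -/
lemma onlyTrivialZero_of_isArtinianRing {f : Fin n → MvPolynomial (Fin n) K} {e : Fin n → ℕ}
    (hf : ∀ i, (f i).IsHomogeneous (e i))
    (hA : IsArtinianRing (MvPolynomial (Fin n) K ⧸ Ideal.span (Set.range f))) :
    OnlyTrivialZero f := by
  intro v hv
  by_contra hv0
  obtain ⟨i₀, hi₀⟩ : ∃ i, v i ≠ 0 := by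
    by_contra! h
    exact hv0 (funext h)
  let φ : MvPolynomial (Fin n) K →ₐ[K] Polynomial K :=
    aeval fun i => Polynomial.C (v i) * Polynomial.X
  have hφ : ∀ i, φ (f i) = 0 := by
    intro i
    have h1 : φ (f i) = Polynomial.C (eval v (f i)) * Polynomial.X ^ e i := by
      rw [eval_eq', map_sum, Finset.sum_mul, aeval_def, eval₂_eq']
      refine Finset.sum_congr rfl fun m hm => ?_
      have hdeg : ∑ j, m j = e i := by
        rw [(hf i).degree_eq_sum_deg_support hm]
        refine (Finset.sum_subset (Finset.subset_univ _) fun j _ hj => ?_).symm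
        exact Finsupp.notMem_support_iff.mp hj
      simp_rw [mul_pow]
      rw [Finset.prod_mul_distrib, Finset.prod_pow_eq_pow_sum, hdeg, Polynomial.algebraMap_eq,
        map_mul, map_prod, mul_assoc]
      simp_rw [map_pow]
    rw [h1, hv i, map_zero, zero_mul]
  have hle : ∀ p ∈ Ideal.span (Set.range f),
      (φ : MvPolynomial (Fin n) K →+* Polynomial K) p = 0 := by
    intro p hp
    have : Ideal.span (Set.range f) ≤
        RingHom.ker (φ : MvPolynomial (Fin n) K →+* Polynomial K) := by
      rw [Ideal.span_le]
      rintro _ ⟨i, rfl⟩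
      exact hφ i
    exact this hp
  have hsurj : Function.Surjective (Ideal.Quotient.lift _ _ hle) := by
    refine Ideal.Quotient.lift_surjective_of_surjective _ hle ?_
    have hrange : φ.range = ⊤ := by
      rw [eq_top_iff, ← Polynomial.adjoin_X, Algebra.adjoin_le_iff, Set.singleton_subset_iff]
      refine ⟨C (v i₀)⁻¹ * X i₀, ?_⟩
      simp only [φ, AlgHom.toRingHom_eq_coe, RingHom.coe_coe, map_mul, aeval_X, algHom_C,
        Polynomial.algebraMap_eq, ← mul_assoc]
      rw [← Polynomial.C_mul, inv_mul_cancel₀ hi₀, Polynomial.C_1, one_mul]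
    exact AlgHom.range_eq_top φ |>.mp hrange
  have hart : IsArtinianRing (Polynomial K) := hsurj.isArtinianRing
  exact Polynomial.not_isField K (IsArtinianRing.isField_of_isDomain (Polynomial K))

end StrongLefschetz

/-! ### The theorem -/

theorem theorem3p1 {K : Type*} [Field K] [CharZero K] :
    (∀ (n : ℕ), 2 ≤ n → ∀ (d : Fin n → ℕ), (∀ i, 0 < d i) →
      ∀ (a : Matrix (Fin n) (Fin n) K), (∀ i j : Fin n, (i : ℕ) + 1 < (j : ℕ) → a i j = 0) →
      ∀ (I : Ideal (MvPolynomial (Fin n) K)),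
        I = Ideal.span (Set.range fun i => X i ^ d i * linForm a i) →
        IsArtinianRing (MvPolynomial (Fin n) K ⧸ I) →
        IsCompleteIntersectionIdeal I →
        HasStrongLefschetzProperty (quotientGrading I)) ∧
    (∀ d : ℕ, 0 < d →
      HasStrongLefschetzProperty
        (quotientGrading (Ideal.span {(X 0 ^ (d + 1) : MvPolynomial (Fin 1) K)}))) := by
  refine ⟨?_, ?_⟩
  · rintro n - d hd a ha I rfl hA -
    have htri := isTriangular_linForm ha
    have hhom : ∀ i, (X i ^ d i * linForm a i).IsHomogeneous (d i + 1) := by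
      intro i
      simpa only [one_mul] using ((isHomogeneous_X K i).pow (d i)).mul (htri.isHomogeneous i)
    exact hasStrongLefschetzProperty_of_onlyTrivialZero htri hd
      (onlyTrivialZero_of_isArtinianRing hhom hA)
  · intro d hd
    have hI : Ideal.span {(X 0 ^ (d + 1) : MvPolynomial (Fin 1) K)} =
        Ideal.span (Set.range fun i : Fin 1 => X i ^ d * X i) := by
      congr 1
      ext p
      simp [pow_succ, eq_comm]
    rw [hI]
    refine hasStrongLefschetzProperty_of_onlyTrivialZero (l := X) (d := fun _ => d) ?_
      (fun _ => hd) ?_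
    · exact fun i => Submodule.subset_span ⟨i, (show (i : ℕ) ≤ i + 1 by omega), rfl⟩
    · intro v hv
      funext i
      have h : eval v (X i ^ d * X i) = 0 := hv i
      rwa [← pow_succ, map_pow, eval_X, pow_eq_zero_iff (by omega)] at h
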